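/- **Setting.** Let $d\ge 0$, $r\ge 1$. For $v\in\mathbb{Z}^d$ let $\sigma_v$ be the shift $f(\mathbf{x})\mapsto f(\mathbf{x}+v)$ of $\mathbb{Q}(\mathbf{x})=\mathbb{Q}(x_1,\dots,x_d)$. A conservative matrix field (CMF) of dimension $d$ and rank $r$ over $\mathbb{Q}$ is a map $\mathcal{M}:\mathbb{Z}^d\to \mathrm{GL}_r(\mathbb{Q}(\mathbf{x}))$, $v\mapsto\mathcal{M}_v$, with $\mathcal{M}_{v+w}=\mathcal{M}_v\,\sigma_v(\mathcal{M}_w)$ for all $v,w$. Fix $x\in\mathbb{Q}^d$, $v\in\mathbb{Z}^d$ such that $\mathcal{M}_{nv}(x)$ is defined for all large $n\in\mathbb{N}$ and the trajectory matrix $T_{x,v}(n)=\mathcal{M}_v(x+nv)$ is a well-defined element of $\mathrm{GL}_r(\mathbb{Q}(n))$. For $p,p',q,q'\in\mathbb{Q}^r$ (where $p',q'$ may depend on $n$) put $$\mathcal{L}^{p,p',q,q'}_{x,v}(n)=\frac{p^t\,\mathcal{M}_{nv}(x)\,p'}{q^t\,\mathcal{M}_{nv}(x)\,q'},\qquad \mathcal{L}^{p,q}_{x,v}=\mathcal{L}^{p,e_r,q,e_r}_{x,v}.$$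 Such a sequence is said to converge if its denominator is non-zero for all large $n$ and it has a finite real limit. The convergence rate of a sequence $s_n$ with limit $l$ is $\lim_{n\to\infty}\frac1n\log|s_n-l|\in[-\infty,\infty]$, with $\log 0=-\infty$, if this limit exists. **Hypotheses.** Suppose that $T_{x,v}(n)$ is in companion form, i.e. it has ones on the subdiagonal, last column $(-b_0(n),\dots,-b_{r-1}(n))^t$ with $b_i\in\mathbb{Q}(n)$, and zeros elsewhere, and let $L=S^r+\sum_{i=0}^{r-1}b_i(n)S^i\in\mathbb{Q}(n)[S]$ (where $S f(n)=f(n+1)S$) be the recurrence operator that it encodes. Suppose that * $L$ satisfies the Poincaré–Perron conditions: the limits $\beta_i=\lim_{n\to\infty}b_i(n)$ exist and are finite, and the roots $\lambda_1,\dots,\lambda_r$ of $t^r+\sum_{i<r}\beta_it^i$ satisfy $|\lambda_1|>\dots>|\lambda_r|$; * $L$ is irreducible in $\mathbb{Q}(n)[S]$, i.e. $L$ has positive order and is not a product of two operators of positive order. Below, "solution" means a sequence satisfying $L.u=0$ for all large $n$. **Conclusion.** There are solutions $U_1,\dots,U_r$ of $L$, non-zero for all large $n$, with $U_i(n+1)/U_i(n)\to\lambda_i$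 for each $i$. Let $a(n)\in\mathbb{Q}(n)^r$ be non-zero, and let $p,q\in\mathbb{Q}^r$ be such that $\mathcal{L}^{p,q}_{x,v}(n)$ converges, with limit $l$. Then $\mathcal{L}^{p,a(n),q,a(n)}_{x,v}(n)$ converges to the same limit $l$, and both sequences have a convergence rate, the same number $\rho\in[-\infty,\infty]$ for both. Moreover, for every system $U_1,\dots,U_r$ as above, the sequences $u_p(n)=p^t\mathcal{M}_{nv}(x)e_1$ and $u_q(n)=q^t\mathcal{M}_{nv}(x)e_1$ have expansions $u_p(n)=\sum_i c_iU_i(n)$ and $u_q(n)=\sum_i\tilde c_iU_i(n)$ for all large $n$, with constants $c_i,\tilde c_i$ such that: $j=\min\{i:\tilde c_i\ne0\}$ exists, $c_i=0$ for $i<j$, and $l=c_j/\tilde c_j$; if $k=\min\{i:\tilde c_jc_i-c_j\tilde c_i\neq0\}$ exists, then $k>j$ and $$\rho=\log\left|\frac{\lambda_k}{\lambda_j}\right|$$ (which is $-\infty$ if $\lambda_k=0$); and if there is no such $k$, then $\rho=-\infty$. -/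

import Mathlib

open Filter Topology Matrix

noncomputable section

namespace Companion

/-- The field `ℚ(x₁, …, x_d)`. -/
abbrev RatField (d : ℕ) : Type := FractionRing (MvPolynomial (Fin d) ℚ)

/-- The substitution `f(x) ↦ f(x + v)` on polynomials. -/
def polyShift {d : ℕ} (v : Fin d → ℤ) :
    MvPolynomial (Fin d) ℚ ≃ₐ[ℚ] MvPolynomial (Fin d) ℚ :=
  AlgEquiv.ofAlgHom
    (MvPolynomial.aeval fun i => MvPolynomial.X i + MvPolynomial.C (v i : ℚ))
    (MvPolynomial.aeval fun i => MvPolynomial.X i - MvPolynomial.C (v i : ℚ))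
    (by ext i; simp)
    (by ext i; simp)

/-- The shift automorphism `σ_v` of `ℚ(x₁, …, x_d)`, `(σ_v f)(x) = f(x + v)`. -/
def shift {d : ℕ} (v : Fin d → ℤ) : RatField d ≃+* RatField d :=
  IsFractionRing.ringEquivOfRingEquiv (polyShift v).toRingEquiv

/-- A conservative matrix field of dimension `d` and rank `r` over `ℚ`:
a map `v ↦ M_v` from `ℤ^d` to `GL_r(ℚ(x))` with `M_{v+w} = M_v · σ_v(M_w)`. -/
structure CMF (d r : ℕ) where
  /-- The matrix `M_v`. -/
  mat : (Fin d → ℤ) → GL (Fin r) (RatField d)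
  cocycle : ∀ v w, mat (v + w) =
    mat v * Matrix.GeneralLinearGroup.map (shift v : RatField d →+* RatField d) (mat w)

/-- The numerator of a rational function written in lowest terms. -/
def ratNum {d : ℕ} (f : RatField d) : MvPolynomial (Fin d) ℚ :=
  IsFractionRing.num (MvPolynomial (Fin d) ℚ) f

/-- The denominator of a rational function written in lowest terms. -/
def ratDen {d : ℕ} (f : RatField d) : MvPolynomial (Fin d) ℚ :=
  (IsFractionRing.den (MvPolynomial (Fin d) ℚ) f : MvPolynomial (Fin d) ℚ)

/-- `f` is defined at the point `x`. -/
def DefinedAt {d : ℕ} (f : RatField d) (x : Fin d → ℚ) : Prop :=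
  MvPolynomial.eval x (ratDen f) ≠ 0

/-- The value `f(x)` (meaningful when `f` is defined at `x`). -/
def evalAt {d : ℕ} (f : RatField d) (x : Fin d → ℚ) : ℚ :=
  MvPolynomial.eval x (ratNum f) / MvPolynomial.eval x (ratDen f)

/-- The polynomial `g(x + n v)` in the variable `n`. -/
def polyOnLine {d : ℕ} (x : Fin d → ℚ) (v : Fin d → ℤ) (g : MvPolynomial (Fin d) ℚ) :
    Polynomial ℚ :=
  MvPolynomial.aeval (fun i => Polynomial.C (x i) + Polynomial.C (v i : ℚ) * Polynomial.X) g

/-- `g ∈ ℚ(n)` is the rational function `f(x + n v)` of `n`; this includes that the denominator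
of `f` does not vanish identically on the line `x + n v`. -/
def IsRestriction {d : ℕ} (x : Fin d → ℚ) (v : Fin d → ℤ) (f : RatField d) (g : RatFunc ℚ) :
    Prop :=
  polyOnLine x v (ratDen f) ≠ 0 ∧
    g = algebraMap (Polynomial ℚ) (RatFunc ℚ) (polyOnLine x v (ratNum f)) /
      algebraMap (Polynomial ℚ) (RatFunc ℚ) (polyOnLine x v (ratDen f))

/-- `T(n) = M_v(x + n v) ∈ GL_r(ℚ(n))` is the trajectory matrix `T_{x,v}(n)` of `M`. -/
def CMF.IsTrajectoryMatrix {d r : ℕ} (M : CMF d r) (x : Fin d → ℚ) (v : Fin d → ℤ)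
    (T : GL (Fin r) (RatFunc ℚ)) : Prop :=
  ∀ i j, IsRestriction x v ((M.mat v).val i j) (T.val i j)

/-- The matrix `M_w(x)`. -/
def CMF.evalMat {d r : ℕ} (M : CMF d r) (x : Fin d → ℚ) (w : Fin d → ℤ) :
    Matrix (Fin r) (Fin r) ℚ :=
  Matrix.of fun i j => evalAt ((M.mat w).val i j) x

/-- `M_w(x)` is defined. -/
def CMF.EvalDefined {d r : ℕ} (M : CMF d r) (x : Fin d → ℚ) (w : Fin d → ℤ) : Prop :=
  ∀ i j, DefinedAt ((M.mat w).val i j) x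

/-- The scalar `pᵗ · M_{nv}(x) · p'`. -/
def CMF.pairing {d r : ℕ} (M : CMF d r) (x : Fin d → ℚ) (v : Fin d → ℤ)
    (p p' : Fin r → ℚ) (n : ℕ) : ℚ :=
  p ⬝ᵥ (M.evalMat x (n • v) *ᵥ p')

/-- The ratio `L^{p,p',q,q'}_{x,v}(n) = (pᵗ M_{nv}(x) p') / (qᵗ M_{nv}(x) q')`. -/
def CMF.ratio {d r : ℕ} (M : CMF d r) (x : Fin d → ℚ) (v : Fin d → ℤ)
    (p p' q q' : Fin r → ℚ) (n : ℕ) : ℚ :=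
  M.pairing x v p p' n / M.pairing x v q q' n

/-- The first standard basis vector `e_1` of `ℚ^r`. -/
def eFirst (r : ℕ) : Fin r → ℚ := fun i => if (i : ℕ) = 0 then 1 else 0

/-- The last standard basis vector `e_r` of `ℚ^r`. -/
def eLast (r : ℕ) : Fin r → ℚ := fun i => if (i : ℕ) + 1 = r then 1 else 0

/-- The value at `n` of a vector of rational functions `a(n) ∈ ℚ(n)^r`. -/
def evalVec {r : ℕ} (a : Fin r → RatFunc ℚ) (n : ℕ) : Fin r → ℚ :=
  fun i => RatFunc.eval (RingHom.id ℚ) (n : ℚ) (a i)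

/-- The sequence `L^{p,p'(n),q,q'(n)}_{x,v}(n)` is defined for all large `n` and converges to
the real number `l`. -/
def CMF.RatioConverges {d r : ℕ} (M : CMF d r) (x : Fin d → ℚ) (v : Fin d → ℤ)
    (p : Fin r → ℚ) (p' : ℕ → Fin r → ℚ) (q : Fin r → ℚ) (q' : ℕ → Fin r → ℚ) (l : ℝ) : Prop :=
  (∀ᶠ n : ℕ in atTop, M.pairing x v q (q' n) n ≠ 0) ∧
    Tendsto (fun n : ℕ => (M.ratio x v p (p' n) q (q' n) n : ℝ)) atTop (𝓝 l)

/-- The convergence rate of a sequence `s` with limit `l` is `ρ = lim (log |s n - l|) / n`,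
a limit in `[-∞, ∞]`, where `log 0 = -∞`. -/
def HasConvergenceRate (s : ℕ → ℝ) (l : ℝ) (ρ : EReal) : Prop :=
  Tendsto (fun n : ℕ => ENNReal.log ‖s n - l‖ₑ / ((n : ℝ) : EReal)) atTop (𝓝 ρ)

/-- The companion matrix of `S^r + b_{r-1} S^{r-1} + ⋯ + b_0`: ones on the subdiagonal, last
column `(-b_0, …, -b_{r-1})`. -/
def companionMatrix {K : Type*} [Field K] {r : ℕ} (b : Fin r → K) : Matrix (Fin r) (Fin r) K :=
  Matrix.of fun i j =>
    if (j : ℕ) + 1 = r then - b i else if (i : ℕ) = (j : ℕ) + 1 then 1 else 0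

/-- The automorphism `f(n) ↦ f(n + 1)` of `ℚ(n)`. -/
def natShift : RatFunc ℚ ≃+* RatFunc ℚ :=
  IsFractionRing.ringEquivOfRingEquiv (Polynomial.taylorEquiv (1 : ℚ)).toRingEquiv

/-- The action of `ℕ` on `ℚ(n)` by shifts; it makes `SkewPolynomial (RatFunc ℚ)` the algebra
`ℚ(n)[S]` of recurrence operators, with `S f(n) = f(n + 1) S`. -/
instance shiftAction : MulSemiringAction (Multiplicative ℕ) (RatFunc ℚ) :=
  MulSemiringAction.compHom (RatFunc ℚ) (powersHom (RatFunc ℚ ≃+* RatFunc ℚ) natShift)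

/-- The recurrence operator `L = S^r + ∑ i < r, b_i(n) S^i ∈ ℚ(n)[S]`. -/
def recOp {r : ℕ} (b : Fin r → RatFunc ℚ) : SkewPolynomial (RatFunc ℚ) :=
  SkewPolynomial.monomial r 1 + ∑ i : Fin r, SkewPolynomial.monomial (i : ℕ) (b i)

/-- The complex number `f(n)`, for `f ∈ ℚ(n)`. -/
def evalC (f : RatFunc ℚ) (n : ℕ) : ℂ := RatFunc.eval (algebraMap ℚ ℂ) (n : ℂ) f

/-- The Poincaré–Perron conditions for `S^r + ∑ i < r, b_i(n) S^i`: the coefficients have finite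
limits, and `lam` lists the roots of the characteristic polynomial in order of strictly decreasing
absolute value. -/
def PoincarePerron {r : ℕ} (b : Fin r → RatFunc ℚ) (lam : Fin r → ℂ) : Prop :=
  ∃ β : Fin r → ℂ,
    (∀ i, Tendsto (fun n : ℕ => evalC (b i) n) atTop (𝓝 (β i))) ∧
    (Polynomial.X ^ r + ∑ i : Fin r, Polynomial.C (β i) * Polynomial.X ^ (i : ℕ) =
      ∏ i : Fin r, (Polynomial.X - Polynomial.C (lam i))) ∧
    StrictAnti fun i => ‖lam i‖

/-- `u` satisfies `u(n + r) + ∑ i < r, b_i(n) u(n + i) = 0` for all large `n`. -/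
def Solves {r : ℕ} (b : Fin r → RatFunc ℚ) (u : ℕ → ℂ) : Prop :=
  ∀ᶠ n : ℕ in atTop, u (n + r) + ∑ i : Fin r, evalC (b i) n * u (n + i) = 0

/-- `U_1, …, U_r` are solutions, non-zero for large `n`, with `U_i(n+1) / U_i(n) → λ_i`; for
`λ_i ≠ 0` this says `U_i(n) = λ_i^n f_i(n)` with `f_i(n+1) / f_i(n) → 1`. -/
structure IsPerronSystem {r : ℕ} (b : Fin r → RatFunc ℚ) (lam : Fin r → ℂ)
    (U : Fin r → ℕ → ℂ) : Prop where
  solves : ∀ i, Solves b (U i)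
  ne_zero : ∀ i, ∀ᶠ n : ℕ in atTop, U i n ≠ 0
  ratio : ∀ i, Tendsto (fun n : ℕ => U i (n + 1) / U i n) atTop (𝓝 (lam i))

/-- `c` are multiplicative constants of `u` with respect to `U`: `u(n) = ∑ c_i U_i(n)` for all
large `n`. -/
def IsExpansion {r : ℕ} (U : Fin r → ℕ → ℂ) (u : ℕ → ℂ) (c : Fin r → ℂ) : Prop :=
  ∀ᶠ n : ℕ in atTop, u n = ∑ i, c i * U i n

/-- `j` is the index of the first non-zero entry of `c`. -/
def IsFirstNonzero {r : ℕ} (c : Fin r → ℂ) (j : Fin r) : Prop :=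
  c j ≠ 0 ∧ ∀ i < j, c i = 0

end Companion

end

/-! By the cocycle identity, the row `pᵗ M_{nv}(x)` is multiplied on the right by `T(n)` when `n`
grows by one. As `T` is a companion matrix, this row is the window `(u_p(n), …, u_p(n+r-1))` of a
single solution of `L`, for large `n`. Pairing with `e_r` therefore gives `u_p(n+r-1)`, and pairing
with `a(n)` gives `(A u_p)(n)`, where `A = ∑ a_m S^m` is a non-zero operator of order less than `r`.

Let `V_1, …, V_r` be eventually non-zero with `V_i(n+1)/V_i(n) → λ_i`. The moduli decrease strictly,
so `V_i = o(V_j)` for `j < i`, and the limit and rate of `∑ c_i V_i / ∑ c'_i V_i` are dictated by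
the coefficients (`exists_leading_of_tendsto`, `convergence_of_leading`). Both sequences of the
theorem are such quotients with the same coefficients, once for `V_i(n) = U_i(n+r-1)` and once for
`V_i = A U_i`. What remains is a Perron system for which the `A U_i` are again eventually non-zero
with quotients tending to `λ_i` (`exists_perron_solution`).

This is the crux, since leading terms of `A U_i` may cancel. Conjugation by the Vandermonde matrix
turns `T(n)` into `diag λ + E(n)`, where `E → 0` has expansions in `1/n`. A contraction argument
gives a solution `y(n) t(n)` with `t` tending to the `i`-th basis vector and `y(n+1)/y(n) → λ_i`; a
bootstrap gives `t` expansions to all orders (`exists_split_solution`). Hence `A U_i = y F`, where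
`F` has an expansion up to a power of `n`: either `F` decays faster than every power of `1/n`, or it
behaves like a non-zero multiple of a power of `n` and its quotients tend to `1`. Irreducibility
excludes the first case. There are operators with `X A + Y L = 1`, so `U_i = X (A U_i)`; the
coefficients of `X` grow at most polynomially, so a flat `F` would force `U_i / y → 0`, whereas this
quotient tends to `1` (`exists_not_isBigO_of_opAct_inverse`). -/

noncomputable section

namespace Companion

/-! ### Asymptotic expansions in powers of `1/n` -/

section Expansions

open Asymptotics

/-- `f` has an expansion in powers of `1 / n` with an error `O(n ^ (-K))`. -/
def HasExpansionTo (K : ℕ) (f : ℕ → ℂ) : Prop :=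
  ∃ P : Polynomial ℂ, (fun n : ℕ => f n - P.eval (n : ℂ)⁻¹) =O[atTop] fun n : ℕ => (n : ℂ)⁻¹ ^ K

theorem norm_natCast_inv_le_one (n : ℕ) : ‖(n : ℂ)⁻¹‖ ≤ 1 := by
  rw [norm_inv, Complex.norm_natCast]
  exact Nat.cast_inv_le_one n

theorem isBigO_inv_pow_of_le {K K' : ℕ} (h : K ≤ K') :
    (fun n : ℕ => (n : ℂ)⁻¹ ^ K') =O[atTop] fun n : ℕ => (n : ℂ)⁻¹ ^ K := by
  refine IsBigO.of_bound 1 (Eventually.of_forall fun n => ?_)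
  rw [norm_pow, norm_pow, one_mul]
  exact pow_le_pow_of_le_one (norm_nonneg _) (norm_natCast_inv_le_one n) h

theorem tendsto_natCast_inv : Tendsto (fun n : ℕ => (n : ℂ)⁻¹) atTop (𝓝 0) :=
  tendsto_inv_atTop_nhds_zero_nat (𝕜 := ℂ)

theorem tendsto_eval_natCast_inv (P : Polynomial ℂ) :
    Tendsto (fun n : ℕ => P.eval (n : ℂ)⁻¹) atTop (𝓝 (P.eval 0)) :=
  (P.continuous.tendsto 0).comp tendsto_natCast_inv

theorem eventually_natCast_ne_zero : ∀ᶠ n : ℕ in atTop, (n : ℂ) ≠ 0 := by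
  filter_upwards [eventually_gt_atTop 0] with n hn
  exact_mod_cast hn.ne'

theorem HasExpansionTo.of_isBigO {K : ℕ} {f : ℕ → ℂ}
    (h : f =O[atTop] fun n : ℕ => (n : ℂ)⁻¹ ^ K) : HasExpansionTo K f :=
  ⟨0, by simpa using h⟩

theorem hasExpansionTo_eval (K : ℕ) (P : Polynomial ℂ) :
    HasExpansionTo K fun n : ℕ => P.eval (n : ℂ)⁻¹ :=
  ⟨P, by simpa using isBigO_zero _ _⟩

theorem hasExpansionTo_const (K : ℕ) (c : ℂ) : HasExpansionTo K fun _ => c := by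
  simpa using hasExpansionTo_eval K (Polynomial.C c)

theorem hasExpansionTo_inv (K : ℕ) : HasExpansionTo K fun n : ℕ => (n : ℂ)⁻¹ := by
  simpa using hasExpansionTo_eval K Polynomial.X

theorem HasExpansionTo.isBigO_one {K : ℕ} {f : ℕ → ℂ} (h : HasExpansionTo K f) :
    f =O[atTop] fun _ => (1 : ℂ) := by
  obtain ⟨P, hP⟩ := h
  have h1 := hP.trans (isBigO_inv_pow_of_le (Nat.zero_le K))
  have h2 := (tendsto_eval_natCast_inv P).isBigO_one ℂ
  exact ((h1.congr_right fun n => pow_zero _).add h2).congr_left fun n => by ring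

theorem hasExpansionTo_zero_iff {f : ℕ → ℂ} :
    HasExpansionTo 0 f ↔ f =O[atTop] fun _ => (1 : ℂ) :=
  ⟨HasExpansionTo.isBigO_one, fun h => .of_isBigO (by simpa using h)⟩

theorem HasExpansionTo.mono {K K' : ℕ} {f : ℕ → ℂ} (h : HasExpansionTo K' f) (hK : K ≤ K') :
    HasExpansionTo K f := by
  obtain ⟨P, hP⟩ := h
  exact ⟨P, hP.trans (isBigO_inv_pow_of_le hK)⟩

theorem HasExpansionTo.congr {K : ℕ} {f g : ℕ → ℂ} (h : HasExpansionTo K f)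
    (hfg : f =ᶠ[atTop] g) : HasExpansionTo K g := by
  obtain ⟨P, hP⟩ := h
  refine ⟨P, hP.congr' ?_ .rfl⟩
  filter_upwards [hfg] with n hn
  rw [hn]

theorem HasExpansionTo.add {K : ℕ} {f g : ℕ → ℂ} (hf : HasExpansionTo K f)
    (hg : HasExpansionTo K g) : HasExpansionTo K fun n => f n + g n := by
  obtain ⟨P, hP⟩ := hf
  obtain ⟨Q, hQ⟩ := hg
  refine ⟨P + Q, (hP.add hQ).congr_left fun n => ?_⟩
  rw [Polynomial.eval_add]
  ring

theorem HasExpansionTo.mul {K : ℕ} {f g : ℕ → ℂ} (hf : HasExpansionTo K f)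
    (hg : HasExpansionTo K g) : HasExpansionTo K fun n => f n * g n := by
  have hg1 := hg.isBigO_one
  obtain ⟨P, hP⟩ := hf
  obtain ⟨Q, hQ⟩ := hg
  have hP1 := (tendsto_eval_natCast_inv P).isBigO_one ℂ
  refine ⟨P * Q, (((hP.mul hg1).add ((hP1.mul hQ).congr_right fun n => mul_comm _ _))).congr
    (fun n => ?_) fun n => mul_one _⟩
  rw [Polynomial.eval_mul]
  ring

theorem HasExpansionTo.neg {K : ℕ} {f : ℕ → ℂ} (hf : HasExpansionTo K f) :
    HasExpansionTo K fun n => - f n := by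
  simpa using (hasExpansionTo_const K (-1)).mul hf

theorem HasExpansionTo.sub {K : ℕ} {f g : ℕ → ℂ} (hf : HasExpansionTo K f)
    (hg : HasExpansionTo K g) : HasExpansionTo K fun n => f n - g n := by
  simpa [sub_eq_add_neg] using hf.add hg.neg

theorem hasExpansionTo_sum {ι : Type*} {K : ℕ} (s : Finset ι) {f : ι → ℕ → ℂ}
    (hf : ∀ i ∈ s, HasExpansionTo K (f i)) : HasExpansionTo K fun n => ∑ i ∈ s, f i n := by
  classical
  induction s using Finset.induction_on with
  | empty => simpa using hasExpansionTo_const K 0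
  | insert a s ha ih =>
    simp only [Finset.sum_insert ha]
    exact (hf a (by simp)).add (ih fun i hi => hf i (by simp [hi]))

theorem HasExpansionTo.polynomial_eval {K : ℕ} {f : ℕ → ℂ} (hf : HasExpansionTo K f)
    (P : Polynomial ℂ) : HasExpansionTo K fun n => P.eval (f n) := by
  induction P using Polynomial.induction_on' with
  | add p q hp hq => simpa using hp.add hq
  | monomial m c =>
    simp only [Polynomial.eval_monomial]
    refine (hasExpansionTo_const K c).mul ?_
    induction m with
    | zero => simpa using hasExpansionTo_const K 1
    | succ m ih => simpa only [pow_succ] using ih.mul hf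

theorem HasExpansionTo.inv_mul {K : ℕ} {f : ℕ → ℂ} (hf : HasExpansionTo K f) :
    HasExpansionTo (K + 1) fun n : ℕ => (n : ℂ)⁻¹ * f n := by
  obtain ⟨P, hP⟩ := hf
  refine ⟨Polynomial.X * P, ((isBigO_refl (fun n : ℕ => (n : ℂ)⁻¹) atTop).mul hP).congr
    (fun n => ?_) fun n => ?_⟩
  · rw [Polynomial.eval_mul, Polynomial.eval_X]
    ring
  · ring

theorem HasExpansionTo.exists_tendsto {K : ℕ} {f : ℕ → ℂ} (hf : HasExpansionTo (K + 1) f) :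
    ∃ c : ℂ, Tendsto f atTop (𝓝 c) := by
  obtain ⟨P, hP⟩ := hf
  refine ⟨P.eval 0, ?_⟩
  have h1 : Tendsto (fun n : ℕ => (n : ℂ)⁻¹ ^ (K + 1)) atTop (𝓝 0) := by
    simpa using tendsto_natCast_inv.pow (K + 1)
  simpa using (hP.trans_tendsto h1).add (tendsto_eval_natCast_inv P)

/-- The constant term of the expansion is the limit of `f`, hence zero, so the polynomial is
divisible by `X`. One order of precision is lost. -/
theorem HasExpansionTo.natCast_mul {K : ℕ} {f : ℕ → ℂ} (hf : HasExpansionTo (K + 1) f)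
    (h0 : Tendsto f atTop (𝓝 0)) : HasExpansionTo K fun n : ℕ => (n : ℂ) * f n := by
  obtain ⟨P, hP⟩ := hf
  have h1 : Tendsto (fun n : ℕ => (n : ℂ)⁻¹ ^ (K + 1)) atTop (𝓝 0) := by
    simpa using tendsto_natCast_inv.pow (K + 1)
  have h2 : Tendsto f atTop (𝓝 (P.eval 0)) := by
    simpa using (hP.trans_tendsto h1).add (tendsto_eval_natCast_inv P)
  have h3 : P.coeff 0 = 0 := by
    rw [Polynomial.coeff_zero_eq_eval_zero]
    exact tendsto_nhds_unique h2 h0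
  obtain ⟨Q, rfl⟩ := Polynomial.X_dvd_iff.2 h3
  refine ⟨Q, ((isBigO_refl (fun n : ℕ => (n : ℂ)) atTop).mul hP).congr' ?_ ?_⟩
  · filter_upwards [eventually_natCast_ne_zero] with n hn
    rw [Polynomial.eval_mul, Polynomial.eval_X]
    field_simp
  · filter_upwards [eventually_natCast_ne_zero] with n hn
    rw [pow_succ]
    field_simp

theorem HasExpansionTo.isBigO_inv {K : ℕ} {f : ℕ → ℂ} (hf : HasExpansionTo (K + 1) f)
    (h0 : Tendsto f atTop (𝓝 0)) : f =O[atTop] fun n : ℕ => (n : ℂ)⁻¹ := by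
  have := (isBigO_refl (fun n : ℕ => (n : ℂ)⁻¹) atTop).mul (hf.natCast_mul h0).isBigO_one
  refine this.congr' ?_ (by simp)
  filter_upwards [eventually_natCast_ne_zero] with n hn
  field_simp

theorem hasExpansionTo_succ_inv (K : ℕ) : HasExpansionTo K fun n : ℕ => ((n + 1 : ℕ) : ℂ)⁻¹ := by
  induction K with
  | zero =>
    refine hasExpansionTo_zero_iff.2 (IsBigO.of_bound 1 (Eventually.of_forall fun n => ?_))
    simpa using norm_natCast_inv_le_one (n + 1)
  | succ K ih =>
    -- The identity `1/(n+1) = 1/n - (1/n) · 1/(n+1)` gains one order.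
    refine ((hasExpansionTo_inv (K + 1)).sub ih.inv_mul).congr ?_
    filter_upwards [eventually_natCast_ne_zero] with n hn
    have : ((n + 1 : ℕ) : ℂ) ≠ 0 := by exact_mod_cast n.succ_ne_zero
    push_cast at this ⊢
    field_simp
    ring

theorem isBigO_succ_inv_pow (K : ℕ) :
    (fun n : ℕ => ((n + 1 : ℕ) : ℂ)⁻¹ ^ K) =O[atTop] fun n : ℕ => (n : ℂ)⁻¹ ^ K := by
  refine IsBigO.of_bound 1 ?_
  filter_upwards [eventually_gt_atTop 0] with n hn
  rw [norm_pow, norm_pow, one_mul, norm_inv, norm_inv, Complex.norm_natCast, Complex.norm_natCast]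
  have : (0 : ℝ) < n := by exact_mod_cast hn
  gcongr
  simp

theorem HasExpansionTo.shift {K : ℕ} {f : ℕ → ℂ} (hf : HasExpansionTo K f) :
    HasExpansionTo K fun n => f (n + 1) := by
  obtain ⟨P, hP⟩ := hf
  have h1 := (hP.comp_tendsto (tendsto_add_atTop_nat 1)).trans (isBigO_succ_inv_pow K)
  refine ((HasExpansionTo.of_isBigO h1).add
    ((hasExpansionTo_succ_inv K).polynomial_eval P)).congr (Eventually.of_forall fun n => ?_)
  simp

theorem hasExpansionTo_inv_of_tendsto {f : ℕ → ℂ} (hf : ∀ K, HasExpansionTo K f) {c : ℂ}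
    (hc : c ≠ 0) (hfc : Tendsto f atTop (𝓝 c)) (K : ℕ) : HasExpansionTo K fun n => (f n)⁻¹ := by
  induction K with
  | zero => exact hasExpansionTo_zero_iff.2 ((hfc.inv₀ hc).isBigO_one ℂ)
  | succ K ih =>
    have h0 : Tendsto (fun n => f n - c) atTop (𝓝 0) := by
      simpa using hfc.sub_const c
    have h1 : HasExpansionTo K fun n : ℕ => (n : ℂ) * (f n - c) :=
      ((hf (K + 1)).sub (hasExpansionTo_const _ c)).natCast_mul h0
    -- The identity `1/f = 1/c - (1/c)(1/n) · n(f - c) · (1/f)`: the factor `1/n` raises the order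
    -- known for `1/f` by one.
    refine ((hasExpansionTo_const (K + 1) c⁻¹).sub
      ((hasExpansionTo_const (K + 1) c⁻¹).mul (h1.mul ih).inv_mul)).congr ?_
    filter_upwards [eventually_natCast_ne_zero, hfc.eventually_ne hc] with n hn hfn
    field_simp
    ring

/-- A function that is not flat has a non-zero leading term: with `k` the order of vanishing of the
expansion at `0`, `f` is asymptotic to a non-zero multiple of `n^(e-k)`. The expansion is taken to
order `K + e`, so that `k ≥ K + e` would give `f = O(n^(-K))`. -/
theorem eventually_ne_zero_and_tendsto_of_hasExpansionTo {f : ℕ → ℂ} (e : ℕ)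
    (hf : ∀ K, HasExpansionTo K fun n : ℕ => (n : ℂ)⁻¹ ^ e * f n)
    (hne : ∃ K, ¬ f =O[atTop] fun n : ℕ => (n : ℂ)⁻¹ ^ K) :
    (∀ᶠ n in atTop, f n ≠ 0) ∧ Tendsto (fun n => f (n + 1) / f n) atTop (𝓝 1) := by
  obtain ⟨K, hK⟩ := hne
  obtain ⟨P, hP⟩ := hf (K + e)
  have hP0 : P ≠ 0 := by
    rintro rfl
    refine hK (((isBigO_refl (fun n : ℕ => (n : ℂ) ^ e) atTop).mul hP).congr' ?_ ?_)
    · filter_upwards [eventually_natCast_ne_zero] with n hn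
      simp only [Polynomial.eval_zero, sub_zero, ← mul_assoc, ← mul_pow, mul_inv_cancel₀ hn,
        one_pow, one_mul]
    · filter_upwards [eventually_natCast_ne_zero] with n hn
      rw [pow_add, mul_left_comm, ← mul_pow, mul_inv_cancel₀ hn, one_pow, mul_one]
  obtain ⟨Q, hPQ, hQ⟩ := Polynomial.exists_eq_pow_rootMultiplicity_mul_and_not_dvd P hP0 0
  set k := P.rootMultiplicity 0
  rw [Polynomial.C_0, sub_zero] at hPQ hQ
  have hQ0 : Q.eval 0 ≠ 0 := by
    rwa [Ne, ← Polynomial.coeff_zero_eq_eval_zero, ← Polynomial.X_dvd_iff]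
  have hkK : k < K + e := by
    by_contra! hle
    have h1 : (fun n : ℕ => P.eval (n : ℂ)⁻¹) =O[atTop] fun n : ℕ => (n : ℂ)⁻¹ ^ (K + e) := by
      have := (isBigO_inv_pow_of_le hle).mul ((tendsto_eval_natCast_inv Q).isBigO_one ℂ)
      refine this.congr (fun n => ?_) fun n => mul_one _
      rw [hPQ]
      simp
    have h2 : (fun n : ℕ => (n : ℂ)⁻¹ ^ e * f n) =O[atTop] fun n : ℕ => (n : ℂ)⁻¹ ^ (K + e) := by
      simpa using hP.add h1
    refine hK (((isBigO_refl (fun n : ℕ => (n : ℂ) ^ e) atTop).mul h2).congr' ?_ ?_)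
    · filter_upwards [eventually_natCast_ne_zero] with n hn
      simp only [← mul_assoc, ← mul_pow, mul_inv_cancel₀ hn, one_pow, one_mul]
    · filter_upwards [eventually_natCast_ne_zero] with n hn
      rw [pow_add, mul_left_comm, ← mul_pow, mul_inv_cancel₀ hn, one_pow, mul_one]
  have hlim : Tendsto (fun n : ℕ => (n : ℂ) ^ k * ((n : ℂ)⁻¹ ^ e * f n)) atTop
      (𝓝 (Q.eval 0)) := by
    have h1 : Tendsto (fun n : ℕ => (n : ℂ)⁻¹ ^ (K + e - k)) atTop (𝓝 0) := by
      simpa [(Nat.sub_pos_of_lt hkK).ne'] using tendsto_natCast_inv.pow (K + e - k)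
    have h2 : Tendsto (fun n : ℕ => (n : ℂ) ^ k * ((n : ℂ)⁻¹ ^ e * f n - P.eval (n : ℂ)⁻¹)) atTop
        (𝓝 0) := by
      refine IsBigO.trans_tendsto (((isBigO_refl (fun n : ℕ => (n : ℂ) ^ k) atTop).mul hP).congr'
        .rfl ?_) h1
      filter_upwards [eventually_natCast_ne_zero] with n hn
      rw [← Nat.add_sub_of_le hkK.le, pow_add, ← mul_assoc, ← mul_pow, mul_inv_cancel₀ hn,
        one_pow, one_mul, Nat.add_sub_cancel_left]
    have h3 := h2.add (tendsto_eval_natCast_inv Q)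
    rw [zero_add] at h3
    refine h3.congr' ?_
    filter_upwards [eventually_natCast_ne_zero] with n hn
    have h4 : (n : ℂ) ^ k * (n : ℂ)⁻¹ ^ k = 1 := by rw [← mul_pow, mul_inv_cancel₀ hn, one_pow]
    rw [hPQ, Polynomial.eval_mul, Polynomial.eval_pow, Polynomial.eval_X]
    linear_combination (- Q.eval (n : ℂ)⁻¹) * h4
  have hne : ∀ᶠ n in atTop, f n ≠ 0 := by
    filter_upwards [hlim.eventually_ne hQ0] with n hn h0
    simp [h0] at hn
  refine ⟨hne, ?_⟩
  have hnn : Tendsto (fun n : ℕ => ((n + 1 : ℕ) : ℂ) / n) atTop (𝓝 1) := by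
    have := tendsto_natCast_inv.const_add 1
    rw [add_zero] at this
    refine this.congr' ?_
    filter_upwards [eventually_natCast_ne_zero] with n hn
    push_cast
    field_simp
  have h4 := ((((hlim.comp (tendsto_add_atTop_nat 1)).div hlim hQ0).mul
    (hnn.pow e)).div (hnn.pow k) (by simp))
  rw [div_self hQ0, one_pow, one_pow, mul_one, div_one] at h4
  refine h4.congr' ?_
  filter_upwards [eventually_natCast_ne_zero, hne] with n hn hfn
  have : ((n + 1 : ℕ) : ℂ) ≠ 0 := by exact_mod_cast n.succ_ne_zero
  simp only [Pi.div_apply, Function.comp_apply, div_pow, inv_pow]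
  field_simp

end Expansions

/-! ### Expansions of bounded solutions of first-order recurrences -/

section Recurrences

open Asymptotics

theorem eventually_mul_inv_pow_le {q : ℝ} (hq : q < 1) (K : ℕ) :
    ∀ᶠ n : ℕ in atTop, q * (n : ℝ)⁻¹ ^ K ≤ ((n + 1 : ℕ) : ℝ)⁻¹ ^ K := by
  have h1 : Tendsto (fun n : ℕ => ((n : ℝ) / ((n : ℝ) + 1)) ^ K) atTop (𝓝 1) := by
    simpa using (tendsto_natCast_div_add_atTop (𝕜 := ℝ) 1).pow K
  filter_upwards [h1.eventually (eventually_ge_nhds hq), eventually_gt_atTop 0] with n hn h0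
  have h0' : (0 : ℝ) < n := by exact_mod_cast h0
  calc q * (n : ℝ)⁻¹ ^ K ≤ ((n : ℝ) / ((n : ℝ) + 1)) ^ K * (n : ℝ)⁻¹ ^ K := by gcongr
    _ = ((n + 1 : ℕ) : ℝ)⁻¹ ^ K := by
      rw [← mul_pow]
      push_cast
      congr 1
      field_simp

theorem isBigO_inv_pow_of_forward {θ : ℂ} (hθ : ‖θ‖ < 1) {t g : ℕ → ℂ} {K : ℕ}
    (h : ∀ᶠ n in atTop, t (n + 1) = θ * t n + g n)
    (hg : g =O[atTop] fun n : ℕ => (n : ℂ)⁻¹ ^ K) :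
    t =O[atTop] fun n : ℕ => (n : ℂ)⁻¹ ^ K := by
  obtain ⟨q, hq1, hq2⟩ := exists_between hθ
  obtain ⟨C, hC⟩ := hg.bound
  obtain ⟨N, hN⟩ := eventually_atTop.1
    (((h.and hC).and (eventually_mul_inv_pow_le hq2 K)).and (eventually_gt_atTop 0))
  have hq : 0 < q - ‖θ‖ := sub_pos.2 hq1
  -- The first entry makes `‖θ‖ M + C ≤ q M`, which closes the induction step because `q n^(-K) ≤
  -- (n+1)^(-K)`; the second covers the base case.
  set M := max (C / (q - ‖θ‖)) (‖t N‖ * (N : ℝ) ^ K)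
  have hM1 : ‖θ‖ * M + C ≤ q * M := by
    have := (div_le_iff₀ hq).1 (le_max_left _ _ : C / (q - ‖θ‖) ≤ M)
    linarith
  have hM0 : 0 ≤ M := le_max_of_le_right (by positivity)
  refine IsBigO.of_bound M (eventually_atTop.2 ⟨N, fun n hn => ?_⟩)
  rw [norm_pow, norm_inv, Complex.norm_natCast]
  induction n, hn using Nat.le_induction with
  | base =>
    have hN0 : (0 : ℝ) < N := by exact_mod_cast (hN N le_rfl).2
    rw [inv_pow, ← div_eq_mul_inv, le_div_iff₀ (by positivity)]
    exact le_max_right _ _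
  | succ n hn ih =>
    obtain ⟨⟨⟨h1, h2⟩, h3⟩, -⟩ := hN n hn
    rw [norm_pow, norm_inv, Complex.norm_natCast] at h2
    calc ‖t (n + 1)‖ ≤ ‖θ‖ * ‖t n‖ + ‖g n‖ := by
          rw [h1, ← norm_mul]
          exact norm_add_le _ _
      _ ≤ ‖θ‖ * (M * (n : ℝ)⁻¹ ^ K) + C * (n : ℝ)⁻¹ ^ K := by gcongr
      _ = (‖θ‖ * M + C) * (n : ℝ)⁻¹ ^ K := by ring
      _ ≤ q * M * (n : ℝ)⁻¹ ^ K := by gcongr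
      _ = M * (q * (n : ℝ)⁻¹ ^ K) := by ring
      _ ≤ M * ((n + 1 : ℕ) : ℝ)⁻¹ ^ K := by gcongr

theorem isBigO_inv_pow_of_backward {θ : ℂ} (hθ : ‖θ‖ < 1) {t g : ℕ → ℂ} {K : ℕ}
    (ht : t =O[atTop] fun _ => (1 : ℂ))
    (h : ∀ᶠ n in atTop, t n = θ * t (n + 1) + g n)
    (hg : g =O[atTop] fun n : ℕ => (n : ℂ)⁻¹ ^ K) :
    t =O[atTop] fun n : ℕ => (n : ℂ)⁻¹ ^ K := by
  obtain ⟨B, hB⟩ := ht.bound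
  obtain ⟨C, hC0, hC⟩ := hg.exists_nonneg
  obtain ⟨N, hN⟩ := eventually_atTop.1 (((h.and hC.bound).and hB).and (eventually_gt_atTop 0))
  have h1θ : 0 < 1 - ‖θ‖ := sub_pos.2 hθ
  -- Unrolling the recurrence `m` times into the future; boundedness of `t` makes the first term
  -- vanish as `m → ∞`.
  have key : ∀ m n, N ≤ n → ‖t n‖ ≤ ‖θ‖ ^ m * B + C / (1 - ‖θ‖) * (n : ℝ)⁻¹ ^ K := by
    intro m
    induction m with
    | zero =>
      intro n hn
      have := (hN n hn).1.2
      rw [norm_one, mul_one] at this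
      rw [pow_zero, one_mul]
      exact this.trans (le_add_of_nonneg_right (by positivity))
    | succ m ih =>
      intro n hn
      obtain ⟨⟨⟨h1, h2⟩, -⟩, h3⟩ := hN n hn
      rw [norm_pow, norm_inv, Complex.norm_natCast] at h2
      have hn0 : (0 : ℝ) < n := by exact_mod_cast h3
      have hle : ((n + 1 : ℕ) : ℝ)⁻¹ ^ K ≤ (n : ℝ)⁻¹ ^ K := by
        gcongr
        simp
      calc ‖t n‖ ≤ ‖θ‖ * ‖t (n + 1)‖ + ‖g n‖ := by
            rw [← norm_mul]
            conv_lhs => rw [h1]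
            exact norm_add_le _ _
        _ ≤ ‖θ‖ * (‖θ‖ ^ m * B + C / (1 - ‖θ‖) * (n : ℝ)⁻¹ ^ K) + C * (n : ℝ)⁻¹ ^ K := by
            gcongr
            refine (ih (n + 1) (by omega)).trans ?_
            gcongr
        _ = ‖θ‖ ^ (m + 1) * B + C / (1 - ‖θ‖) * (n : ℝ)⁻¹ ^ K := by
            field_simp
            ring
  refine IsBigO.of_bound (C / (1 - ‖θ‖)) (eventually_atTop.2 ⟨N, fun n hn => ?_⟩)
  rw [norm_pow, norm_inv, Complex.norm_natCast]
  have hlim := ((tendsto_pow_atTop_nhds_zero_of_lt_one (norm_nonneg θ) hθ).mul_const B).add_const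
    (C / (1 - ‖θ‖) * (n : ℝ)⁻¹ ^ K)
  rw [zero_mul, zero_add] at hlim
  exact ge_of_tendsto' hlim fun m => key m n hn

theorem isBigO_inv_pow_of_recurrence {a b : ℂ} (hab : ‖a‖ ≠ ‖b‖) {t g : ℕ → ℂ} {K : ℕ}
    (ht : t =O[atTop] fun _ => (1 : ℂ))
    (h : ∀ᶠ n in atTop, a * t (n + 1) = b * t n + g n)
    (hg : g =O[atTop] fun n : ℕ => (n : ℂ)⁻¹ ^ K) :
    t =O[atTop] fun n : ℕ => (n : ℂ)⁻¹ ^ K := by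
  rcases hab.lt_or_gt with hlt | hlt
  · have hb : b ≠ 0 := norm_pos_iff.1 ((norm_nonneg a).trans_lt hlt)
    refine isBigO_inv_pow_of_backward (θ := a / b) (g := fun n => - b⁻¹ * g n) ?_ ht ?_
      (hg.const_mul_left _)
    · rwa [norm_div, div_lt_one (norm_pos_iff.2 hb)]
    · filter_upwards [h] with n hn
      field_simp
      linear_combination - hn
  · have ha : a ≠ 0 := norm_pos_iff.1 ((norm_nonneg b).trans_lt hlt)
    refine isBigO_inv_pow_of_forward (θ := b / a) (g := fun n => a⁻¹ * g n) ?_ ?_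
      (hg.const_mul_left _)
    · rwa [norm_div, div_lt_one (norm_pos_iff.2 ha)]
    · filter_upwards [h] with n hn
      field_simp
      linear_combination hn

/-- Bounded solutions of a hyperbolic first-order recurrence inherit the expansion of the
inhomogeneous term. -/
theorem HasExpansionTo.of_recurrence {a b : ℂ} (hab : ‖a‖ ≠ ‖b‖) {K : ℕ} :
    ∀ {t g : ℕ → ℂ}, t =O[atTop] (fun _ => (1 : ℂ)) →
      (∀ᶠ n in atTop, a * t (n + 1) = b * t n + g n) →
      HasExpansionTo K g → HasExpansionTo K t := by
  induction K with
  | zero => exact fun ht _ _ => hasExpansionTo_zero_iff.2 ht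
  | succ K ih =>
    intro t g ht h hg
    have hab' : a - b ≠ 0 := sub_ne_zero.2 fun e => hab (by rw [e])
    obtain ⟨p, hp⟩ := hg.exists_tendsto
    -- The only possible limit of `t`: the fixed point of `a c = b c + p`.
    set c := p / (a - b)
    have hpc : p = c * (a - b) := by
      simp only [c]
      field_simp
    have hg' := hg.sub (hasExpansionTo_const (K + 1) p)
    have hp' : Tendsto (fun n => g n - p) atTop (𝓝 0) := by simpa using hp.sub_const p
    have ht' : (fun n => t n - c) =O[atTop] fun _ => (1 : ℂ) :=
      ht.sub (isBigO_const_const _ one_ne_zero _)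
    have h' : ∀ᶠ n in atTop, a * (t (n + 1) - c) = b * (t n - c) + (g n - p) := by
      filter_upwards [h] with n hn
      linear_combination hn + hpc
    have h1 : (fun n => t n - c) =O[atTop] fun n : ℕ => (n : ℂ)⁻¹ := by
      simpa using isBigO_inv_pow_of_recurrence hab ht' h' (K := 1)
        (by simpa using hg'.isBigO_inv hp')
    have h2 : HasExpansionTo K fun n => t n - c := ih ht' h' (hg'.mono K.le_succ)
    have h3 : (fun n : ℕ => (n : ℂ) * (t n - c)) =O[atTop] fun _ => (1 : ℂ) := by
      refine ((isBigO_refl (fun n : ℕ => (n : ℂ)) atTop).mul h1).congr' .rfl ?_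
      filter_upwards [eventually_natCast_ne_zero] with n hn
      exact mul_inv_cancel₀ hn
    have h4 : HasExpansionTo K fun n : ℕ => b * (t n - c) + ((n : ℂ) * (g n - p) + (g n - p)) :=
      ((hasExpansionTo_const K b).mul h2).add ((hg'.natCast_mul hp').add (hg'.mono K.le_succ))
    -- `n (t - c)` is bounded and solves a recurrence with the same `a` and `b`, whose inhomogeneous
    -- term involves `t - c`, already expanded to order `K`. Dividing by `n` afterwards yields order
    -- `K + 1`.
    have h5 : HasExpansionTo K fun n : ℕ => (n : ℂ) * (t n - c) := by
      refine ih h3 ?_ h4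
      filter_upwards [h'] with n hn
      push_cast
      linear_combination ((n : ℂ) + 1) * hn
    refine (h5.inv_mul.add (hasExpansionTo_const _ c)).congr ?_
    filter_upwards [eventually_natCast_ne_zero] with n hn
    field_simp
    ring

end Recurrences

/-! ### Splitting a perturbed diagonal system by a contraction -/

section Splitting

open Asymptotics

variable {r : ℕ}

/-- The nonlinear part of the recurrence satisfied by the quotients `t_j = y_j / y_i` for a
solution of `y(n + 1) = y(n) (diag lam + E(n))`. -/
def riccatiTerm (E : ℕ → Matrix (Fin r) (Fin r) ℂ) (i : Fin r) (t : ℕ → Fin r → ℂ) (n : ℕ)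
    (j : Fin r) : ℂ :=
  ∑ k, t n k * E n k j - t (n + 1) j * ∑ k, t n k * E n k i

/-- The operator whose fixed points are the bounded solutions with `t_i = 1`. -/
def riccatiStep (lam : Fin r → ℂ) (E : ℕ → Matrix (Fin r) (Fin r) ℂ) (i : Fin r)
    (t : ℕ → Fin r → ℂ) (n : ℕ) (j : Fin r) : ℂ :=
  if j = i then 1
  else if ‖lam j‖ < ‖lam i‖ then
    if n = 0 then 0 else (lam j * t (n - 1) j + riccatiTerm E i t (n - 1) j) / lam i
  else (lam i * t (n + 1) j - riccatiTerm E i t n j) / lam j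

theorem norm_sum_mul_le {w : Fin r → ℂ} {e : Fin r → ℂ} {δ d : ℝ}
    (hw : ∀ k, ‖w k‖ ≤ d) (he : ∀ k, ‖e k‖ ≤ δ) : ‖∑ k, w k * e k‖ ≤ r * δ * d := by
  refine (norm_sum_le_of_le (f := fun k => w k * e k) (n := fun _ => d * δ) _ fun k _ => ?_).trans
    (le_of_eq ?_)
  · rw [norm_mul]
    exact mul_le_mul (hw k) (he k) (norm_nonneg _) ((norm_nonneg _).trans (hw k))
  · simp
    ring

/-- The linear part contributes `r δ d` and the quadratic part, varied one factor at a time, twice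
that. -/
theorem norm_riccatiTerm_sub_le {E : ℕ → Matrix (Fin r) (Fin r) ℂ} {δ d : ℝ} 
    (hE : ∀ n k j, ‖E n k j‖ ≤ δ) (i : Fin r) {t s : ℕ → Fin r → ℂ} (ht : ∀ n k, ‖t n k‖ ≤ 1)
    (hs : ∀ n k, ‖s n k‖ ≤ 1) (hts : ∀ n k, ‖t n k - s n k‖ ≤ d) (n : ℕ) (j : Fin r) :
    ‖riccatiTerm E i t n j - riccatiTerm E i s n j‖ ≤ 3 * r * δ * d := by
  have hd : 0 ≤ d := (norm_nonneg _).trans (hts n j)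
  have h1 : ∀ l, ‖∑ k, (t n k - s n k) * E n k l‖ ≤ r * δ * d := fun l =>
    norm_sum_mul_le (hts n) fun k => hE n k l
  have h2 : ‖∑ k, t n k * E n k i‖ ≤ r * δ * 1 := norm_sum_mul_le (ht n) fun k => hE n k i
  have h3 : riccatiTerm E i t n j - riccatiTerm E i s n j =
      ∑ k, (t n k - s n k) * E n k j - (t (n + 1) j - s (n + 1) j) * ∑ k, t n k * E n k i -
        s (n + 1) j * ∑ k, (t n k - s n k) * E n k i := by
    simp only [riccatiTerm, sub_mul, Finset.sum_sub_distrib]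
    ring
  rw [h3]
  calc _ ≤ ‖∑ k, (t n k - s n k) * E n k j‖ +
        ‖(t (n + 1) j - s (n + 1) j)‖ * ‖∑ k, t n k * E n k i‖ +
        ‖s (n + 1) j‖ * ‖∑ k, (t n k - s n k) * E n k i‖ := by
        rw [← norm_mul, ← norm_mul]
        exact (norm_sub_le _ _).trans (add_le_add_left (norm_sub_le _ _) _)
    _ ≤ r * δ * d + d * (r * δ * 1) + 1 * (r * δ * d) := by
        gcongr
        · exact h1 j
        · exact hts _ _
        · exact hs _ _
        · exact h1 i
    _ = 3 * r * δ * d := by ring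

/-- Each coordinate is solved forward or backward in `n` so that the division is by the larger of
`|λ_i|` and `|λ_j|`. The linear part then contracts by the quotient of the moduli, and a small `δ`
leaves room for the nonlinear part. -/
theorem norm_riccatiStep_sub_le {lam : Fin r → ℂ} {E : ℕ → Matrix (Fin r) (Fin r) ℂ} {δ d κ : ℝ}
    (hE : ∀ n k j, ‖E n k j‖ ≤ δ) {i : Fin r}
    (hlam : ∀ j ≠ i, ‖lam j‖ ≠ ‖lam i‖) (hκ0 : 0 ≤ κ)
    (hκ : ∀ j ≠ i, min ‖lam i‖ ‖lam j‖ + 3 * r * δ ≤ κ * max ‖lam i‖ ‖lam j‖)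
    {t s : ℕ → Fin r → ℂ} (ht : ∀ n k, ‖t n k‖ ≤ 1)
    (hs : ∀ n k, ‖s n k‖ ≤ 1) (hts : ∀ n k, ‖t n k - s n k‖ ≤ d) (n : ℕ) (j : Fin r) :
    ‖riccatiStep lam E i t n j - riccatiStep lam E i s n j‖ ≤ κ * d := by
  have hd : 0 ≤ d := (norm_nonneg _).trans (hts n j)
  have hg := norm_riccatiTerm_sub_le hE i ht hs hts
  unfold riccatiStep
  split_ifs with h1 h2 h3
  · simpa using mul_nonneg hκ0 hd
  · simpa using mul_nonneg hκ0 hd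
  · have h4 := hκ j h1
    rw [min_eq_right h2.le, max_eq_left h2.le] at h4
    have h5 : 0 < ‖lam i‖ := (norm_nonneg _).trans_lt h2
    rw [← sub_div, norm_div, div_le_iff₀ h5]
    calc _ = ‖lam j * (t (n - 1) j - s (n - 1) j) +
          (riccatiTerm E i t (n - 1) j - riccatiTerm E i s (n - 1) j)‖ := by congr 1; ring
      _ ≤ ‖lam j‖ * d + 3 * r * δ * d := by
          refine (norm_add_le _ _).trans (add_le_add ?_ (hg _ _))
          rw [norm_mul]
          gcongr
          exact hts _ _
      _ = (‖lam j‖ + 3 * r * δ) * d := by ring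
      _ ≤ κ * ‖lam i‖ * d := by gcongr
      _ = κ * d * ‖lam i‖ := by ring
  · have h2' : ‖lam i‖ < ‖lam j‖ := lt_of_le_of_ne (not_lt.1 h2) (hlam j h1).symm
    have h4 := hκ j h1
    rw [min_eq_left h2'.le, max_eq_right h2'.le] at h4
    have h5 : 0 < ‖lam j‖ := (norm_nonneg _).trans_lt h2'
    rw [← sub_div, norm_div, div_le_iff₀ h5]
    calc _ = ‖lam i * (t (n + 1) j - s (n + 1) j) -
          (riccatiTerm E i t n j - riccatiTerm E i s n j)‖ := by congr 1; ring
      _ ≤ ‖lam i‖ * d + 3 * r * δ * d := by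
          refine (norm_sub_le _ _).trans (add_le_add ?_ (hg _ _))
          rw [norm_mul]
          gcongr
          exact hts _ _
      _ = (‖lam i‖ + 3 * r * δ) * d := by ring
      _ ≤ κ * ‖lam j‖ * d := by gcongr
      _ = κ * d * ‖lam j‖ := by ring

theorem exists_riccatiStep_fixedPoint {lam : Fin r → ℂ} {E : ℕ → Matrix (Fin r) (Fin r) ℂ}
    {δ κ : ℝ} (hE : ∀ n k j, ‖E n k j‖ ≤ δ) {i : Fin r}
    (hlam : ∀ j ≠ i, ‖lam j‖ ≠ ‖lam i‖) (hκ0 : 0 ≤ κ) (hκ1 : κ < 1)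
    (hκ : ∀ j ≠ i, min ‖lam i‖ ‖lam j‖ + 3 * r * δ ≤ κ * max ‖lam i‖ ‖lam j‖) :
    ∃ t : ℕ → Fin r → ℂ, (∀ n k, ‖t n k‖ ≤ 1) ∧ riccatiStep lam E i t = t := by
  have hbound : ∀ t : ℕ → Fin r → ℂ, (∀ n k, ‖t n k‖ ≤ 1) →
      ∀ n k, ‖riccatiStep lam E i t n k‖ ≤ 1 := by
    intro t ht n k
    by_cases hk : k = i
    · simp [riccatiStep, hk]
    -- Away from coordinate `i` the zero sequence is mapped to zero, so comparison with it shows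
    -- that the unit ball is preserved.
    · have := norm_riccatiStep_sub_le hE hlam hκ0 hκ ht (s := fun _ _ => 0) (d := 1) (by simp)
        (by simpa using ht) n k
      have h0 : riccatiStep lam E i (fun _ _ => 0) n k = 0 := by
        simp [riccatiStep, riccatiTerm, hk]
      rw [h0, sub_zero, mul_one] at this
      exact this.trans hκ1.le
  let X := BoundedContinuousFunction (ℕ × Fin r) ℂ
  let S := Metric.closedBall (0 : X) 1
  have hS : ∀ f : S, ∀ n k, ‖f.1 (n, k)‖ ≤ 1 := fun f n k =>
    (f.1.norm_coe_le_norm (n, k)).trans (mem_closedBall_zero_iff.1 f.2)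
  have : CompleteSpace S := Metric.isClosed_closedBall.completeSpace_coe
  have : Nonempty S := ⟨⟨0, by simp [S]⟩⟩
  let Φ : S → S := fun f =>
    ⟨BoundedContinuousFunction.ofNormedAddCommGroupDiscrete
      (fun p => riccatiStep lam E i (fun n k => f.1 (n, k)) p.1 p.2) 1
      fun p => hbound _ (hS f) p.1 p.2, by
      simp only [S, Metric.mem_closedBall, dist_zero_right]
      rw [BoundedContinuousFunction.norm_le zero_le_one]
      exact fun p => hbound _ (hS f) p.1 p.2⟩
  have hΦ : ContractingWith ⟨κ, hκ0⟩ Φ := by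
    refine ⟨by exact_mod_cast hκ1, LipschitzWith.of_dist_le_mul fun f g => ?_⟩
    change dist (Φ f).1 (Φ g).1 ≤ κ * dist f.1 g.1
    rw [BoundedContinuousFunction.dist_le (by positivity)]
    intro p
    rw [dist_eq_norm]
    exact norm_riccatiStep_sub_le hE hlam hκ0 hκ (hS f) (hS g)
      (fun n k => by rw [← dist_eq_norm]; exact BoundedContinuousFunction.dist_coe_le_dist _) p.1 p.2
  refine ⟨fun n k => (hΦ.fixedPoint Φ).1 (n, k), hS _, ?_⟩
  funext n k
  exact congrArg (fun f : S => f.1 (n, k)) hΦ.fixedPoint_isFixedPt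

theorem exists_contraction_constants {lam : Fin r → ℂ} {i : Fin r}
    (hlam : ∀ j ≠ i, ‖lam j‖ ≠ ‖lam i‖) :
    ∃ δ κ : ℝ, 0 < δ ∧ 0 ≤ κ ∧ κ < 1 ∧
      ∀ j ≠ i, min ‖lam i‖ ‖lam j‖ + 3 * r * δ ≤ κ * max ‖lam i‖ ‖lam j‖ := by
  have hr : (0 : ℝ) < r := by exact_mod_cast i.pos
  have h : ∀ j : Fin r, ∃ κ : ℝ, κ ∈ Set.Ico (0 : ℝ) 1 ∧
      (j ≠ i → min ‖lam i‖ ‖lam j‖ < κ * max ‖lam i‖ ‖lam j‖) := by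
    intro j
    by_cases hj : j = i
    · exact ⟨0, by simp, fun h => (h hj).elim⟩
    · have hlt := min_lt_max.2 (hlam j hj).symm
      have hpos : 0 < max ‖lam i‖ ‖lam j‖ := (le_min (norm_nonneg _) (norm_nonneg _)).trans_lt hlt
      obtain ⟨κ, h1, h2⟩ := exists_between ((div_lt_one hpos).2 hlt)
      exact ⟨κ, ⟨(div_nonneg (le_min (norm_nonneg _) (norm_nonneg _)) hpos.le).trans h1.le, h2⟩,
        fun _ => (div_lt_iff₀ hpos).1 h1⟩
  choose κ hκ1 hκ2 using h
  have : Nonempty (Fin r) := ⟨i⟩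
  obtain ⟨j0, hj0⟩ := Finite.exists_max κ
  have h2 : ∀ j : Fin r, ∃ δ : ℝ, 0 < δ ∧
      (j ≠ i → min ‖lam i‖ ‖lam j‖ + 3 * r * δ ≤ κ j0 * max ‖lam i‖ ‖lam j‖) := by
    intro j
    by_cases hj : j = i
    · exact ⟨1, one_pos, fun h => (h hj).elim⟩
    · have h3 : min ‖lam i‖ ‖lam j‖ < κ j0 * max ‖lam i‖ ‖lam j‖ :=
        (hκ2 j hj).trans_le (mul_le_mul_of_nonneg_right (hj0 j) (le_max_of_le_left (norm_nonneg _)))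
      refine ⟨(κ j0 * max ‖lam i‖ ‖lam j‖ - min ‖lam i‖ ‖lam j‖) / (3 * r),
        div_pos (sub_pos.2 h3) (by positivity), fun _ => le_of_eq ?_⟩
      field_simp
      ring
  choose δ hδ1 hδ2 using h2
  obtain ⟨j1, hj1⟩ := Finite.exists_min δ
  refine ⟨δ j1, κ j0, hδ1 j1, (hκ1 j0).1, (hκ1 j0).2, fun j hj => le_trans ?_ (hδ2 j hj)⟩
  gcongr
  exact hj1 j

theorem exists_bounded_quotients {lam : Fin r → ℂ} {E : ℕ → Matrix (Fin r) (Fin r) ℂ}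
    (hE : ∀ k j, Tendsto (fun n => E n k j) atTop (𝓝 0)) {i : Fin r}
    (hlam : ∀ j ≠ i, ‖lam j‖ ≠ ‖lam i‖) :
    ∃ t : ℕ → Fin r → ℂ, (∀ n k, ‖t n k‖ ≤ 1) ∧ (∀ n, t n i = 1) ∧
      ∀ᶠ n in atTop, ∀ j, lam i * t (n + 1) j = lam j * t n j + riccatiTerm E i t n j := by
  obtain ⟨δ, κ, hδ, hκ0, hκ1, hκ⟩ := exists_contraction_constants hlam
  have hsmall : ∀ᶠ n in atTop, ∀ k j, ‖E n k j‖ ≤ δ := by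
    refine eventually_all.2 fun k => eventually_all.2 fun j => ?_
    have := (hE k j).norm
    rw [norm_zero] at this
    exact this.eventually (eventually_le_nhds hδ)
  obtain ⟨N, hN⟩ := eventually_atTop.1 hsmall
  obtain ⟨t, ht1, ht2⟩ := exists_riccatiStep_fixedPoint (E := fun n => E (n + N))
    (fun n => hN (n + N) (by omega)) hlam hκ0 hκ1 hκ
  have hti : ∀ n, t n i = 1 := fun n => by
    rw [← ht2]
    simp [riccatiStep]
  -- The fixed point was found for `E` shifted by `N`, where it is uniformly small. The truncated
  -- subtraction only matters for `n < N`.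
  refine ⟨fun n => t (n - N), fun n => ht1 _, fun n => hti _, ?_⟩
  filter_upwards [eventually_ge_atTop N] with n hn j
  obtain ⟨m, rfl⟩ := Nat.exists_eq_add_of_le' hn
  have hterm : riccatiTerm E i (fun n => t (n - N)) (m + N) j =
      riccatiTerm (fun n => E (n + N)) i t m j := by
    simp [riccatiTerm, add_right_comm m N 1]
  rw [hterm, add_right_comm m N 1, Nat.add_sub_cancel, Nat.add_sub_cancel]
  by_cases hj : j = i
  · subst hj
    simp [riccatiTerm, hti]
  · by_cases hlt : ‖lam j‖ < ‖lam i‖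
    · have hi : lam i ≠ 0 := norm_pos_iff.1 ((norm_nonneg _).trans_lt hlt)
      have := congrFun (congrFun ht2 (m + 1)) j
      simp only [riccatiStep, hj, hlt, if_true, if_false, Nat.succ_ne_zero, Nat.add_sub_cancel]
        at this
      rw [← this]
      field_simp
    · have hj0 : lam j ≠ 0 := by
        intro h0
        rw [h0, norm_zero, norm_pos_iff, not_not] at hlt
        exact hlam j hj (by rw [h0, hlt])
      have := congrFun (congrFun ht2 m) j
      simp only [riccatiStep, hj, hlt, if_false] at this
      conv_rhs => rw [← this]
      field_simp
      ring

/-- A perturbation `diag lam + E(n)` of a diagonal matrix with eigenvalues of distinct moduli has,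
for each `i`, a solution `y(n) t(n)` in the direction of the `i`-th basis vector whose direction
`t` has an asymptotic expansion. -/
theorem exists_split_solution {lam : Fin r → ℂ} {E : ℕ → Matrix (Fin r) (Fin r) ℂ}
    (hE0 : ∀ k j, Tendsto (fun n => E n k j) atTop (𝓝 0))
    (hE : ∀ K k j, HasExpansionTo K fun n => E n k j)
    (hinj : ∀ᶠ n in atTop, ∀ w : Fin r → ℂ,
      (∀ j, lam j * w j + ∑ k, w k * E n k j = 0) → w = 0)
    {i : Fin r} (hlam : ∀ j ≠ i, ‖lam j‖ ≠ ‖lam i‖) :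
    ∃ (y : ℕ → ℂ) (t : ℕ → Fin r → ℂ), (∀ᶠ n in atTop, y n ≠ 0) ∧
      Tendsto (fun n => y (n + 1) / y n) atTop (𝓝 (lam i)) ∧
      (∀ K j, HasExpansionTo K fun n => t n j) ∧ (∀ n, t n i = 1) ∧
      (∀ j ≠ i, Tendsto (fun n => t n j) atTop (𝓝 0)) ∧
      ∀ᶠ n in atTop, ∀ j, y (n + 1) * t (n + 1) j =
        lam j * (y n * t n j) + ∑ k, y n * t n k * E n k j := by
  obtain ⟨t, ht1, hti, hrec⟩ := exists_bounded_quotients hE0 hlam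
  have htO : ∀ j, (fun n => t n j) =O[atTop] fun _ => (1 : ℂ) := fun j =>
    IsBigO.of_bound 1 (Eventually.of_forall fun n => by simpa using ht1 n j)
  have hnE : ∀ K k j, HasExpansionTo K fun n : ℕ => (n : ℂ) * E n k j := fun K k j =>
    (hE (K + 1) k j).natCast_mul (hE0 k j)
  -- As `E → 0`, also `n E` has expansions of all orders, so the nonlinear term is known to one
  -- order more than `t`. This drives the bootstrap in `hexp`.
  have hterm : ∀ K, (∀ j, HasExpansionTo K fun n => t n j) → ∀ j,
      HasExpansionTo (K + 1) fun n => riccatiTerm E i t n j := by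
    intro K hK j
    have h1 : ∀ l, HasExpansionTo K fun n : ℕ => ∑ k, t n k * ((n : ℂ) * E n k l) := fun l =>
      hasExpansionTo_sum _ fun k _ => (hK k).mul (hnE K k l)
    refine ((h1 j).sub ((hK j).shift.mul (h1 i))).inv_mul.congr ?_
    filter_upwards [eventually_natCast_ne_zero] with n hn
    have h2 : ∀ l, ∑ k, t n k * ((n : ℂ) * E n k l) = n * ∑ k, t n k * E n k l := fun l => by
      rw [Finset.mul_sum]
      exact Finset.sum_congr rfl fun k _ => by ring
    rw [h2, h2, riccatiTerm]
    field_simp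
  have hexp : ∀ K j, HasExpansionTo K fun n => t n j := by
    intro K
    induction K with
    | zero => exact fun j => hasExpansionTo_zero_iff.2 (htO j)
    | succ K ih =>
      intro j
      by_cases hj : j = i
      · subst hj
        simpa [hti] using hasExpansionTo_const (K + 1) 1
      · exact HasExpansionTo.of_recurrence (hlam j hj).symm (htO j)
          (hrec.mono fun n hn => hn j) (hterm K ih j)
  have hsum : ∀ l, Tendsto (fun n => ∑ k, t n k * E n k l) atTop (𝓝 0) := by
    intro l
    have : ∀ k ∈ Finset.univ, Tendsto (fun n => t n k * E n k l) atTop (𝓝 0) := fun k _ => by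
      refine IsBigO.trans_tendsto (g'' := fun n => E n k l) ?_ (hE0 k l)
      simpa using (htO k).mul (isBigO_refl (fun n => E n k l) atTop)
    simpa using tendsto_finsetSum _ this
  have ht0 : ∀ j ≠ i, Tendsto (fun n => t n j) atTop (𝓝 0) := by
    intro j hj
    have hg0 : Tendsto (fun n => riccatiTerm E i t n j) atTop (𝓝 0) := by
      have h1 : Tendsto (fun n => t (n + 1) j * ∑ k, t n k * E n k i) atTop (𝓝 0) := by
        refine IsBigO.trans_tendsto (g'' := fun n => ∑ k, t n k * E n k i) ?_ (hsum i)
        simpa using ((htO j).comp_tendsto (tendsto_add_atTop_nat 1)).mul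
          (isBigO_refl (fun n => ∑ k, t n k * E n k i) atTop)
      simpa [riccatiTerm] using (hsum j).sub h1
    refine (isBigO_inv_pow_of_recurrence (K := 1) (hlam j hj).symm (htO j)
      (hrec.mono fun n hn => hn j) ?_).trans_tendsto (by simpa using tendsto_natCast_inv)
    simpa using (hterm 0 (hexp 0) j).isBigO_inv hg0
  -- The multiplier `y(n+1)/y(n)` forced by coordinate `i`, where `t` equals `1`.
  set μ : ℕ → ℂ := fun n => lam i + ∑ k, t n k * E n k i
  have hμ : Tendsto μ atTop (𝓝 (lam i)) := by simpa using (hsum i).const_add (lam i)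
  have hstep : ∀ᶠ n in atTop, ∀ j, μ n * t (n + 1) j = lam j * t n j + ∑ k, t n k * E n k j := by
    filter_upwards [hrec] with n hn j
    have := hn j
    rw [riccatiTerm] at this
    simp only [μ]
    linear_combination this
  -- Since `λ_i` may be `0`, this does not follow from the limit: `μ n = 0` would put `t n ≠ 0` into
  -- the kernel of `diag λ + E(n)`.
  have hμ0 : ∀ᶠ n in atTop, μ n ≠ 0 := by
    filter_upwards [hstep, hinj] with n h1 h2 h0
    have h3 := h2 (t n) fun j => by rw [← h1 j, h0, zero_mul]
    have h4 := congrFun h3 i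
    rw [hti] at h4
    exact one_ne_zero h4
  obtain ⟨N, hN⟩ := eventually_atTop.1 hμ0
  set y : ℕ → ℂ := fun n => ∏ m ∈ Finset.Ico N n, μ m
  have hy : ∀ᶠ n in atTop, y (n + 1) = y n * μ n := by
    filter_upwards [eventually_ge_atTop N] with n hn
    exact Finset.prod_Ico_succ_top hn _
  have hy0 : ∀ n, y n ≠ 0 := fun n =>
    Finset.prod_ne_zero_iff.2 fun m hm => hN m (Finset.mem_Ico.1 hm).1
  refine ⟨y, t, Eventually.of_forall hy0, hμ.congr' ?_, hexp, hti, ht0, ?_⟩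
  · filter_upwards [hy] with n hn
    rw [hn, mul_div_cancel_left₀ _ (hy0 n)]
  · filter_upwards [hy, hstep] with n h1 h2 j
    rw [h1, mul_assoc, h2 j, mul_add, Finset.mul_sum]
    congr 1
    · ring
    · exact Finset.sum_congr rfl fun k _ => by ring

end Splitting

/-! ### Companion systems in the eigenbasis of their limit -/

section CompanionSystems

variable {r : ℕ}

theorem vecMul_companionMatrix {K : Type*} [Field K] (b w : Fin r → K) (j : Fin r) :
    (w ᵥ* companionMatrix b) j =
      if h : (j : ℕ) + 1 < r then w ⟨j + 1, h⟩ else - ∑ i, b i * w i := by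
  simp only [vecMul, dotProduct, companionMatrix, Matrix.of_apply]
  by_cases h : (j : ℕ) + 1 < r
  · rw [dif_pos h, Finset.sum_eq_single ⟨j + 1, h⟩]
    · simp [h.ne]
    · intro k _ hk
      rw [if_neg h.ne, if_neg fun e => hk (Fin.ext e), mul_zero]
    · simp
  · have hj : (j : ℕ) + 1 = r := by omega
    simp [hj, mul_comm]

theorem eq_zero_of_vecMul_companionMatrix_eq_zero {K : Type*} [Field K] {b w : Fin r → K}
    (hr : 0 < r) (hb : b ⟨0, hr⟩ ≠ 0) (h : w ᵥ* companionMatrix b = 0) : w = 0 := by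
  have h1 : ∀ k : Fin r, k ≠ ⟨0, hr⟩ → w k = 0 := by
    rintro ⟨k, hk⟩ hk0
    obtain ⟨m, rfl⟩ : ∃ m, k = m + 1 := Nat.exists_eq_succ_of_ne_zero fun e => hk0 (Fin.ext e)
    have := congrFun h ⟨m, by omega⟩
    rwa [vecMul_companionMatrix, dif_pos hk] at this
  have h2 := congrFun h ⟨r - 1, by omega⟩
  rw [vecMul_companionMatrix, dif_neg (by simp; omega), Pi.zero_apply, neg_eq_zero,
    Finset.sum_eq_single ⟨0, hr⟩ (fun k _ hk => by rw [h1 k hk, mul_zero]) (by simp)] at h2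
  funext k
  by_cases hk : k = ⟨0, hr⟩
  · rw [hk]
    exact (mul_eq_zero.1 h2).resolve_left hb
  · exact h1 k hk

theorem vecMul_companionMatrix_shift {K : Type*} [Field K] {B w : ℕ → Fin r → K} (hr : 0 < r)
    (h : ∀ᶠ n in atTop, w (n + 1) = w n ᵥ* companionMatrix (B n)) :
    (∀ᶠ n in atTop, ∀ m : Fin r, w n m = w (n + m) ⟨0, hr⟩) ∧
    ∀ᶠ n in atTop, w (n + r) ⟨0, hr⟩ + ∑ i : Fin r, B n i * w (n + i) ⟨0, hr⟩ = 0 := by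
  obtain ⟨N, hN⟩ := eventually_atTop.1 h
  have h1 : ∀ m (hm : m < r), ∀ n ≥ N, w n ⟨m, hm⟩ = w (n + m) ⟨0, hr⟩ := by
    intro m
    induction m with
    | zero => exact fun _ _ _ => rfl
    | succ m ih =>
      intro hm n hn
      have := congrFun (hN n hn) ⟨m, by omega⟩
      rw [vecMul_companionMatrix, dif_pos hm] at this
      rw [← this, ih (by omega) (n + 1) (by omega), add_right_comm, add_assoc]
  refine ⟨eventually_atTop.2 ⟨N, fun n hn m => h1 m m.2 n hn⟩,
    eventually_atTop.2 ⟨N, fun n hn => ?_⟩⟩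
  have h2 := congrFun (hN n hn) ⟨r - 1, by omega⟩
  rw [vecMul_companionMatrix, dif_neg (by simp; omega), h1 _ _ _ (by omega),
    show n + 1 + (r - 1) = n + r by omega] at h2
  rw [h2, neg_add_eq_zero]
  exact Finset.sum_congr rfl fun i _ => by rw [h1 i i.2 n hn]

/-- The rows `(1, λ_i, …, λ_i^(r-1))` are left eigenvectors of the limiting companion matrix. -/
theorem vandermonde_mul_companionMatrix {lam β : Fin r → ℂ}
    (hlam : ∀ i, lam i ^ r + ∑ m : Fin r, β m * lam i ^ (m : ℕ) = 0) :
    vandermonde lam * companionMatrix β = diagonal lam * vandermonde lam := by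
  ext i j
  rw [Matrix.mul_apply_eq_vecMul, vecMul_companionMatrix, Matrix.diagonal_mul]
  simp only [vandermonde_apply]
  split_ifs with h
  · rw [pow_succ']
  · have hj : (j : ℕ) + 1 = r := by have := j.2; omega
    rw [← pow_succ', hj]
    linear_combination - hlam i

theorem exists_split_solution_of_companion {lam β : Fin r → ℂ} {B : ℕ → Fin r → ℂ} (hr : 0 < r)
    (hβ : ∀ i, Tendsto (fun n => B n i) atTop (𝓝 (β i)))
    (hB : ∀ K i, HasExpansionTo K fun n => B n i)
    (hB0 : ∀ᶠ n in atTop, B n ⟨0, hr⟩ ≠ 0)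
    (hroot : ∀ i, lam i ^ r + ∑ m : Fin r, β m * lam i ^ (m : ℕ) = 0)
    (hlam : StrictAnti fun i => ‖lam i‖) (i : Fin r) :
    ∃ (U y : ℕ → ℂ) (t : ℕ → Fin r → ℂ), (∀ᶠ n in atTop, y n ≠ 0) ∧
      Tendsto (fun n => y (n + 1) / y n) atTop (𝓝 (lam i)) ∧
      (∀ K j, HasExpansionTo K fun n => t n j) ∧ (∀ n, t n i = 1) ∧
      (∀ j ≠ i, Tendsto (fun n => t n j) atTop (𝓝 0)) ∧
      (∀ᶠ n in atTop, U (n + r) + ∑ m : Fin r, B n m * U (n + m) = 0) ∧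
      ∀ᶠ n in atTop, ∀ m : Fin r, U (n + m) = y n * ∑ j, t n j * lam j ^ (m : ℕ) := by
  set V := vandermonde lam
  have hdet : IsUnit V.det :=
    (det_vandermonde_ne_zero_iff.2 fun a b hab => hlam.injective (by simp [hab])).isUnit
  set E : ℕ → Matrix (Fin r) (Fin r) ℂ := fun n =>
    V * (companionMatrix (B n) - companionMatrix β) * V⁻¹
  have hentry : ∀ n k j, E n k j = ∑ x : Fin r, ∑ l : Fin r, V k l *
      (if (x : ℕ) + 1 = r then - (B n l - β l) else 0) * V⁻¹ x j := by
    intro n k j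
    simp only [E, Matrix.mul_apply, Finset.sum_mul]
    refine Finset.sum_congr rfl fun x _ => Finset.sum_congr rfl fun l _ => ?_
    simp only [Matrix.sub_apply, companionMatrix, Matrix.of_apply]
    split_ifs <;> ring
  have hE : ∀ K k j, HasExpansionTo K fun n => E n k j := by
    intro K k j
    simp only [hentry]
    refine hasExpansionTo_sum _ fun x _ => hasExpansionTo_sum _ fun l _ => ?_
    refine ((hasExpansionTo_const K _).mul ?_).mul (hasExpansionTo_const K _)
    split_ifs
    · exact ((hB K l).sub (hasExpansionTo_const K _)).neg
    · exact hasExpansionTo_const K 0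
  have hE0 : ∀ k j, Tendsto (fun n => E n k j) atTop (𝓝 0) := by
    intro k j
    simp only [hentry]
    rw [← Finset.sum_const_zero (s := (Finset.univ : Finset (Fin r)))]
    refine tendsto_finsetSum _ fun x _ => ?_
    rw [← Finset.sum_const_zero (s := (Finset.univ : Finset (Fin r)))]
    refine tendsto_finsetSum _ fun l _ => ?_
    split_ifs
    · simpa using (((hβ l).sub_const (β l)).neg.const_mul (V k l)).mul_const (V⁻¹ x j)
    · simp
  have hconj : ∀ n, (diagonal lam + E n) * V = V * companionMatrix (B n) := by
    intro n
    rw [add_mul, ← vandermonde_mul_companionMatrix hroot, Matrix.nonsing_inv_mul_cancel_right _ _ hdet,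
      ← mul_add, add_sub_cancel]
  have hvec : ∀ n (w : Fin r → ℂ) j,
      (w ᵥ* (diagonal lam + E n)) j = lam j * w j + ∑ k, w k * E n k j := by
    intro n w j
    rw [Matrix.vecMul_add, Pi.add_apply, Matrix.vecMul_diagonal, mul_comm]
    rfl
  -- Injectivity comes from `b_0(n) ≠ 0`, even if the limiting matrix is singular.
  have hinj : ∀ᶠ n in atTop, ∀ w : Fin r → ℂ,
      (∀ j, lam j * w j + ∑ k, w k * E n k j = 0) → w = 0 := by
    filter_upwards [hB0] with n hn w hw
    have h1 : w ᵥ* (diagonal lam + E n) = 0 := funext fun j => by rw [hvec, hw]; rfl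
    have h2 : (w ᵥ* V) ᵥ* companionMatrix (B n) = 0 := by
      rw [Matrix.vecMul_vecMul, ← hconj, ← Matrix.vecMul_vecMul, h1, Matrix.zero_vecMul]
    have h3 := eq_zero_of_vecMul_companionMatrix_eq_zero hr hn h2
    have h4 : (w ᵥ* V) ᵥ* V⁻¹ = 0 := by rw [h3, Matrix.zero_vecMul]
    rwa [Matrix.vecMul_vecMul, Matrix.mul_nonsing_inv _ hdet, Matrix.vecMul_one] at h4
  obtain ⟨y, t, hy0, hy, ht, hti, ht0, hrec⟩ := exists_split_solution hE0 hE hinj (i := i)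
    fun j hj => fun e => hj (hlam.injective e)
  set w : ℕ → Fin r → ℂ := fun n => (y n • t n) ᵥ* V
  have hw : ∀ᶠ n in atTop, w (n + 1) = w n ᵥ* companionMatrix (B n) := by
    filter_upwards [hrec] with n hn
    have : y (n + 1) • t (n + 1) = (y n • t n) ᵥ* (diagonal lam + E n) := funext fun j => by
      rw [hvec]
      exact hn j
    simp only [w]
    rw [this, Matrix.vecMul_vecMul, Matrix.vecMul_vecMul, hconj]
  obtain ⟨h1, h2⟩ := vecMul_companionMatrix_shift hr hw
  refine ⟨fun n => w n ⟨0, hr⟩, y, t, hy0, hy, ht, hti, ht0, h2, ?_⟩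
  filter_upwards [h1] with n hn m
  rw [← hn m, Finset.mul_sum]
  simp [w, V, vecMul, dotProduct, mul_assoc]

end CompanionSystems

/-! ### Evaluation and expansion of rational functions at large integers -/

section Evaluation

open Asymptotics

theorem evalC_eq_div (f : RatFunc ℚ) (n : ℕ) :
    evalC f n = f.num.eval₂ (algebraMap ℚ ℂ) n / f.denom.eval₂ (algebraMap ℚ ℂ) n := rfl

theorem evalC_eq_cast (f : RatFunc ℚ) (n : ℕ) :
    evalC f n = ((RatFunc.eval (RingHom.id ℚ) (n : ℚ) f : ℚ) : ℂ) := by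
  have h : ∀ P : Polynomial ℚ, P.eval₂ (algebraMap ℚ ℂ) (n : ℂ) =
      ((P.eval₂ (RingHom.id ℚ) (n : ℚ) : ℚ) : ℂ) := fun P => by
    have := Polynomial.eval₂_at_natCast (algebraMap ℚ ℂ) (p := P) n
    rw [this]
    simp
  rw [evalC_eq_div, h, h, RatFunc.eval]
  push_cast
  rfl

theorem eventually_eval₂_ne_zero {P : Polynomial ℚ} (hP : P ≠ 0) :
    ∀ᶠ n : ℕ in atTop, P.eval₂ (algebraMap ℚ ℂ) (n : ℂ) ≠ 0 := by
  have hQ : P.map (algebraMap ℚ ℂ) ≠ 0 := (Polynomial.map_ne_zero_iff (algebraMap ℚ ℂ).injective).2 hP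
  have hfin : {n : ℕ | P.eval₂ (algebraMap ℚ ℂ) (n : ℂ) = 0}.Finite := by
    refine ((Polynomial.finite_setOfPred_isRoot hQ).preimage
      (Nat.cast_injective (R := ℂ)).injOn).subset fun n hn => ?_
    simpa [Polynomial.IsRoot, Polynomial.eval_map] using hn
  rw [← Nat.cofinite_eq_atTop]
  exact hfin.compl_mem_cofinite

theorem eventually_denom_ne_zero (f : RatFunc ℚ) :
    ∀ᶠ n : ℕ in atTop, f.denom.eval₂ (algebraMap ℚ ℂ) (n : ℂ) ≠ 0 :=
  eventually_eval₂_ne_zero f.denom_ne_zero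

theorem eventually_evalC_ne_zero {f : RatFunc ℚ} (hf : f ≠ 0) :
    ∀ᶠ n : ℕ in atTop, evalC f n ≠ 0 := by
  filter_upwards [eventually_eval₂_ne_zero (RatFunc.num_ne_zero hf), eventually_denom_ne_zero f]
    with n h1 h2
  exact div_ne_zero h1 h2

theorem eventually_evalC_add (f g : RatFunc ℚ) :
    ∀ᶠ n : ℕ in atTop, evalC (f + g) n = evalC f n + evalC g n := by
  filter_upwards [eventually_denom_ne_zero f, eventually_denom_ne_zero g] with n h1 h2
  exact RatFunc.eval_add _ _ h1 h2

theorem eventually_evalC_mul (f g : RatFunc ℚ) :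
    ∀ᶠ n : ℕ in atTop, evalC (f * g) n = evalC f n * evalC g n := by
  filter_upwards [eventually_denom_ne_zero f, eventually_denom_ne_zero g] with n h1 h2
  exact RatFunc.eval_mul _ _ h1 h2

@[simp]
theorem evalC_zero (n : ℕ) : evalC 0 n = 0 := RatFunc.eval_zero _ _

@[simp]
theorem evalC_one (n : ℕ) : evalC 1 n = 1 := RatFunc.eval_one _ _

theorem ratFunc_eval_div {L : Type} [Field L] (φ : ℚ →+* L) (a : L) (p : Polynomial ℚ)
    {q : Polynomial ℚ} (hq : q.eval₂ φ a ≠ 0) :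
    RatFunc.eval φ a (algebraMap (Polynomial ℚ) (RatFunc ℚ) p /
      algebraMap (Polynomial ℚ) (RatFunc ℚ) q) = p.eval₂ φ a / q.eval₂ φ a := by
  have hq0 : q ≠ 0 := by
    rintro rfl
    simp at hq
  set f := algebraMap (Polynomial ℚ) (RatFunc ℚ) p / algebraMap (Polynomial ℚ) (RatFunc ℚ) q
  have h1 : f.num * q = p * f.denom := (RatFunc.num_mul_eq_mul_denom_iff hq0).2 rfl
  have h2 : f.denom.eval₂ φ a ≠ 0 := fun h0 =>
    hq (Polynomial.eval₂_eq_zero_of_dvd_of_eval₂_eq_zero _ _ (RatFunc.denom_div_dvd p q) h0)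
  rw [RatFunc.eval, div_eq_div_iff h2 hq, ← Polynomial.eval₂_mul, ← Polynomial.eval₂_mul, h1]

theorem eventually_evalC_natShift (f : RatFunc ℚ) :
    ∀ᶠ n : ℕ in atTop, evalC (natShift f) n = evalC f (n + 1) := by
  have htaylor : ∀ (P : Polynomial ℚ) (n : ℕ),
      (Polynomial.taylor 1 P).eval₂ (algebraMap ℚ ℂ) (n : ℂ) =
        P.eval₂ (algebraMap ℚ ℂ) ((n + 1 : ℕ) : ℂ) := fun P n => by
    rw [Polynomial.taylor_apply, Polynomial.eval₂_comp]
    simp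
  have hshift : natShift f = algebraMap (Polynomial ℚ) (RatFunc ℚ) (Polynomial.taylor 1 f.num) /
      algebraMap (Polynomial ℚ) (RatFunc ℚ) (Polynomial.taylor 1 f.denom) := by
    conv_lhs => rw [← RatFunc.num_div_denom f, map_div₀]
    simp only [natShift, IsFractionRing.ringEquivOfRingEquiv_algebraMap]
    rfl
  filter_upwards [(tendsto_add_atTop_nat 1).eventually (eventually_denom_ne_zero f)] with n hn
  rw [hshift, evalC, ratFunc_eval_div _ _ _ (by rwa [htaylor]), htaylor, htaylor]
  rfl

theorem eval_natCast_eq_reverse (P : Polynomial ℂ) {n : ℕ} (hn : (n : ℂ) ≠ 0) :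
    P.eval (n : ℂ) = P.reverse.eval (n : ℂ)⁻¹ * (n : ℂ) ^ P.natDegree := by
  let _ := invertibleOfNonzero hn
  have := Polynomial.eval₂_reverse_mul_pow (RingHom.id ℂ) (n : ℂ) P
  rw [invOf_eq_inv] at this
  exact this.symm

theorem exists_hasExpansionTo_evalC (f : RatFunc ℚ) :
    ∃ e : ℕ, ∀ K, HasExpansionTo K fun n : ℕ => (n : ℂ)⁻¹ ^ e * evalC f n := by
  set P := f.num.map (algebraMap ℚ ℂ)
  set Q := f.denom.map (algebraMap ℚ ℂ)
  have hQ : Q ≠ 0 := (Polynomial.map_ne_zero_iff (algebraMap ℚ ℂ).injective).2 f.denom_ne_zero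
  have hQ0 : Q.reverse.eval 0 ≠ 0 := by
    rw [← Polynomial.coeff_zero_eq_eval_zero, Polynomial.coeff_zero_reverse]
    exact Polynomial.leadingCoeff_ne_zero.2 hQ
  -- With reversed polynomials, `n^(-deg P) P(n)/Q(n)` becomes `(1/n)^(deg Q) P*(1/n)/Q*(1/n)`, and
  -- `Q*(0)` is the leading coefficient of `Q`.
  refine ⟨P.natDegree, fun K => ?_⟩
  have h1 : HasExpansionTo K fun n : ℕ =>
      (Polynomial.X ^ Q.natDegree * P.reverse).eval (n : ℂ)⁻¹ * (Q.reverse.eval (n : ℂ)⁻¹)⁻¹ :=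
    (hasExpansionTo_eval K _).mul (hasExpansionTo_inv_of_tendsto
      (fun K => hasExpansionTo_eval K _) hQ0 (tendsto_eval_natCast_inv _) K)
  refine h1.congr ?_
  filter_upwards [eventually_natCast_ne_zero] with n hn
  have h2 : evalC f n = P.eval (n : ℂ) / Q.eval (n : ℂ) := by
    rw [evalC_eq_div, Polynomial.eval_map, Polynomial.eval_map]
  rw [h2, eval_natCast_eq_reverse P hn,
    eval_natCast_eq_reverse Q hn, Polynomial.eval_mul, Polynomial.eval_pow, Polynomial.eval_X]
  simp only [inv_pow, div_eq_mul_inv, mul_inv]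
  field_simp

theorem hasExpansionTo_of_isBigO_one {f : ℕ → ℂ} (hf : f =O[atTop] fun _ => (1 : ℂ)) (e : ℕ)
    (h : ∀ K, HasExpansionTo K fun n : ℕ => (n : ℂ)⁻¹ ^ e * f n) (K : ℕ) : HasExpansionTo K f := by
  induction e generalizing K with
  | zero => simpa using h K
  | succ e ih =>
    refine ih (fun K => ?_) K
    have h0 : Tendsto (fun n : ℕ => (n : ℂ)⁻¹ ^ (e + 1) * f n) atTop (𝓝 0) := by
      refine IsBigO.trans_tendsto (g'' := fun n : ℕ => (n : ℂ)⁻¹ ^ (e + 1)) ?_ ?_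
      · simpa using (isBigO_refl (fun n : ℕ => (n : ℂ)⁻¹ ^ (e + 1)) atTop).mul hf
      · simpa using tendsto_natCast_inv.pow (e + 1)
    refine ((h (K + 1)).natCast_mul h0).congr ?_
    filter_upwards [eventually_natCast_ne_zero] with n hn
    rw [pow_succ]
    field_simp

theorem hasExpansionTo_evalC_of_tendsto {f : RatFunc ℚ} {c : ℂ}
    (hf : Tendsto (evalC f) atTop (𝓝 c)) (K : ℕ) : HasExpansionTo K (evalC f) := by
  obtain ⟨e, he⟩ := exists_hasExpansionTo_evalC f
  exact hasExpansionTo_of_isBigO_one (hf.isBigO_one ℂ) e he K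

end Evaluation

/-! ### Right division and Bézout identities in skew polynomial rings -/

section SkewDivision

open SkewPolynomial

variable {K : Type*} [Field K]

theorem skew_sum_monomial_range (P : SkewPolynomial K) {N : ℕ} (hN : ∀ k ≥ N, P.coeff k = 0) :
    P = ∑ k ∈ Finset.range N, monomial k (P.coeff k) := by
  conv_lhs => rw [← sum_monomial P]
  refine sum_eq_of_subset _ (fun i => monomial_zero_right i) fun k hk => ?_
  rw [Finset.mem_range]
  by_contra! h
  exact mem_support_iff.1 hk (hN k h)

theorem exists_skew_coeff_eq_zero (P : SkewPolynomial K) : ∃ N, ∀ k ≥ N, P.coeff k = 0 := by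
  refine ⟨P.support.sup id + 1, fun k hk => ?_⟩
  by_contra h
  have := Finset.le_sup (f := id) (mem_support_iff.2 h)
  simp only [id] at this
  omega

theorem skew_coeff_sum {ι : Type*} (s : Finset ι) (f : ι → SkewPolynomial K) (n : ℕ) :
    coeff (∑ i ∈ s, f i) n = ∑ i ∈ s, coeff (f i) n := by
  classical
  induction s using Finset.induction_on with
  | empty => simp
  | insert a s ha ih => rw [Finset.sum_insert ha, Finset.sum_insert ha, coeff_add, ih]

theorem exists_skew_top {P : SkewPolynomial K} (hP : P ≠ 0) :
    ∃ m, P.coeff m ≠ 0 ∧ ∀ i > m, P.coeff i = 0 := by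
  have hs : P.support.Nonempty := by
    rw [Finset.nonempty_iff_ne_empty, Ne, support_eq_empty]
    exact hP
  refine ⟨P.support.max' hs, mem_support_iff.1 (P.support.max'_mem hs), fun i hi => ?_⟩
  by_contra h
  exact absurd (P.support.le_max' i (mem_support_iff.2 h)) (by omega)

variable [MulSemiringAction (Multiplicative ℕ) K]

theorem skew_coeff_monomial_mul (m k : ℕ) (a : K) (P : SkewPolynomial K) :
    (monomial m a * P).coeff (m + k) = a * (φ^[m] (P.coeff k)) := by
  rw [φ_iterate_apply]
  refine SkewMonoidAlgebra.coeff_single_mul_aux P fun c => ?_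
  rw [ofAdd_add]
  exact mul_right_inj _

theorem skew_phi_iterate_ne_zero {c : K} (hc : c ≠ 0) (m : ℕ) : (φ^[m] c) ≠ 0 := by
  rw [φ_iterate_apply]
  have := (MulSemiringAction.toRingHom (Multiplicative ℕ) K (Multiplicative.ofAdd m)).injective
  exact (map_ne_zero_iff _ this).2 hc

theorem skew_coeff_mul_top {P Q : SkewPolynomial K} {m k : ℕ} (hP : ∀ i > m, P.coeff i = 0)
    (hQ : ∀ i > k, Q.coeff i = 0) : (P * Q).coeff (m + k) = P.coeff m * φ^[m] (Q.coeff k) := by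
  conv_lhs => rw [skew_sum_monomial_range P (N := m + 1) fun i hi => hP i hi]
  rw [Finset.sum_mul, skew_coeff_sum, Finset.sum_range_succ, skew_coeff_monomial_mul,
    Finset.sum_eq_zero, zero_add]
  intro i hi
  have hi' := Finset.mem_range.1 hi
  rw [show m + k = i + (m - i + k) by omega, skew_coeff_monomial_mul, hQ _ (by omega), φ_iterate_apply,
    smul_zero, mul_zero]

/-- Left ideals of a skew polynomial ring over a field are principal. -/
theorem exists_generator_skew_ideal (I : Ideal (SkewPolynomial K)) (hI : ∃ P ∈ I, P ≠ 0) :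
    ∃ G ∈ I, ∀ P ∈ I, ∃ Q, P = Q * G := by
  classical
  have hex : ∃ d, ∃ G ∈ I, G.coeff d ≠ 0 ∧ ∀ i > d, G.coeff i = 0 := by
    obtain ⟨P, hP, hP0⟩ := hI
    obtain ⟨m, hm⟩ := exists_skew_top hP0
    exact ⟨m, P, hP, hm⟩
  obtain ⟨G, hG, hGd, hGtop⟩ := Nat.find_spec hex
  set d := Nat.find hex
  refine ⟨G, hG, fun P hP => ?_⟩
  obtain ⟨N, hN⟩ := exists_skew_coeff_eq_zero P
  induction N generalizing P with
  | zero => exact ⟨0, by rw [zero_mul]; exact SkewPolynomial.ext fun n => hN n n.zero_le⟩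
  | succ N ih =>
    by_cases hNd : N < d
    · refine ⟨0, ?_⟩
      by_contra hP0
      rw [zero_mul] at hP0
      obtain ⟨m, hm⟩ := exists_skew_top hP0
      have h1 : m < N + 1 := by
        by_contra! h
        exact hm.1 (hN m h)
      exact Nat.find_min hex (show m < d by omega) ⟨P, hP, hm⟩
    -- Chosen so that `q G` has the same coefficient at `N` as `P`; the twist by `φ` comes from
    -- moving `S^(N-d)` past the leading coefficient of `G`.
    · set q : SkewPolynomial K := monomial (N - d) (P.coeff N / φ^[N - d] (G.coeff d))
      have hq : ∀ k ≥ N, (-(q * G) + P).coeff k = 0 := by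
        intro k hk
        obtain ⟨e, rfl⟩ := Nat.exists_eq_add_of_le hk
        have h1 : (-(q * G)).coeff (N + e) = - (q * G).coeff (N + e) := rfl
        rw [coeff_add, h1, show N + e = (N - d) + (d + e) by omega, skew_coeff_monomial_mul,
          show (N - d) + (d + e) = N + e by omega]
        rcases Nat.eq_zero_or_pos e with rfl | he
        · rw [Nat.add_zero, Nat.add_zero, div_mul_cancel₀ _ (skew_phi_iterate_ne_zero hGd _)]
          ring
        · rw [hGtop (d + e) (by omega), hN (N + e) (by omega), φ_iterate_apply (N - d) 0, smul_zero]
          ring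
      obtain ⟨Q, hQ⟩ := ih (-(q * G) + P) (I.add_mem (I.neg_mem (I.mul_mem_left q hG)) hP) hq
      refine ⟨Q + q, ?_⟩
      rw [add_mul, ← hQ]
      abel

/-- An irreducible operator is coprime to every non-zero operator of smaller order. -/
theorem exists_bezout_of_irreducible {L A : SkewPolynomial K} {r : ℕ} (hL : Irreducible L)
    (hLr : L.coeff r ≠ 0) (hLtop : ∀ i > r, L.coeff i = 0) (hA : A ≠ 0)
    (hAtop : ∀ i ≥ r, A.coeff i = 0) : ∃ X Y : SkewPolynomial K, X * A + Y * L = 1 := by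
  have hAI : A ∈ Ideal.span ({A, L} : Set (SkewPolynomial K)) := Ideal.subset_span (by simp)
  have hLI : L ∈ Ideal.span ({A, L} : Set (SkewPolynomial K)) := Ideal.subset_span (by simp)
  obtain ⟨G, hG, hgen⟩ := exists_generator_skew_ideal _ ⟨A, hAI, hA⟩
  obtain ⟨Q, hQ⟩ := hgen L hLI
  obtain ⟨Q', hQ'⟩ := hgen A hAI
  -- Here `L = Q G`. If `Q` is a unit, then `A` is a left multiple of `L`, impossible for its order;
  -- otherwise `G` is a unit and generates `1`.
  rcases hL.isUnit_or_isUnit hQ with ⟨u, rfl⟩ | ⟨u, rfl⟩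
  · exfalso
    have hZ : A = (Q' * ↑u⁻¹) * L := by
      rw [hQ, mul_assoc, ← mul_assoc (↑u⁻¹ : SkewPolynomial K), Units.inv_mul, one_mul]
      exact hQ'
    have hZ0 : Q' * ↑u⁻¹ ≠ 0 := fun h => hA (by rw [hZ, h, zero_mul])
    obtain ⟨m, hm, hmtop⟩ := exists_skew_top hZ0
    have h1 := skew_coeff_mul_top hmtop hLtop
    rw [← hZ, hAtop _ (by omega)] at h1
    exact mul_ne_zero hm (skew_phi_iterate_ne_zero hLr m) h1.symm
  · have h1 : (1 : SkewPolynomial K) ∈ Ideal.span ({A, L} : Set (SkewPolynomial K)) := by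
      rw [← u.inv_mul]
      exact Ideal.mul_mem_left _ _ hG
    exact Ideal.mem_span_pair.1 h1

end SkewDivision

/-! ### Action of recurrence operators on germs of sequences -/

section OperatorAction

open SkewPolynomial

/-- The action of a recurrence operator on sequences: `(P u)(n) = ∑ p_m(n) u(n + m)`. -/
def opAct (P : SkewPolynomial (RatFunc ℚ)) (u : ℕ → ℂ) (n : ℕ) : ℂ :=
  P.sum fun m a => evalC a n * u (n + m)

theorem opAct_eq_sum_range {P : SkewPolynomial (RatFunc ℚ)} {N : ℕ}
    (hN : ∀ k ≥ N, P.coeff k = 0) (u : ℕ → ℂ) (n : ℕ) :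
    opAct P u n = ∑ m ∈ Finset.range N, evalC (P.coeff m) n * u (n + m) := by
  refine sum_eq_of_subset _ (fun i => by simp) fun k hk => ?_
  rw [Finset.mem_range]
  by_contra! h
  exact mem_support_iff.1 hk (hN k h)

@[simp]
theorem opAct_zero (u : ℕ → ℂ) (n : ℕ) : opAct 0 u n = 0 := sum_zero_index _

@[simp]
theorem opAct_monomial (m : ℕ) (a : RatFunc ℚ) (u : ℕ → ℂ) (n : ℕ) :
    opAct (monomial m a) u n = evalC a n * u (n + m) :=
  sum_monomial_index (by simp)

theorem eventually_opAct_add (P Q : SkewPolynomial (RatFunc ℚ)) (u : ℕ → ℂ) :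
    ∀ᶠ n in atTop, opAct (P + Q) u n = opAct P u n + opAct Q u n := by
  obtain ⟨N, hN⟩ := exists_skew_coeff_eq_zero P
  obtain ⟨N', hN'⟩ := exists_skew_coeff_eq_zero Q
  have h := (Finset.eventually_all (Finset.range (max N N'))).2 fun m _ =>
    eventually_evalC_add (P.coeff m) (Q.coeff m)
  filter_upwards [h] with n hn
  rw [opAct_eq_sum_range (N := max N N') fun k hk => by
      rw [coeff_add, hN k (by omega), hN' k (by omega), add_zero],
    opAct_eq_sum_range (N := max N N') fun k hk => hN k (by omega),
    opAct_eq_sum_range (N := max N N') fun k hk => hN' k (by omega), ← Finset.sum_add_distrib]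
  exact Finset.sum_congr rfl fun m hm => by rw [coeff_add, hn m hm, add_mul]

theorem opAct_congr (P : SkewPolynomial (RatFunc ℚ)) {u v : ℕ → ℂ} (h : u =ᶠ[atTop] v) :
    opAct P u =ᶠ[atTop] opAct P v := by
  obtain ⟨N, hN⟩ := eventually_atTop.1 h
  filter_upwards [eventually_ge_atTop N] with n hn
  rw [opAct, opAct, sum_def, sum_def]
  exact Finset.sum_congr rfl fun m _ => by rw [hN (n + m) (by omega)]

theorem opAct_zero_right (P : SkewPolynomial (RatFunc ℚ)) (n : ℕ) :
    opAct P (fun _ => 0) n = 0 := by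
  rw [opAct, sum_def]
  simp

theorem eventually_evalC_phi_iterate (m : ℕ) (a : RatFunc ℚ) :
    ∀ᶠ n in atTop, evalC (φ^[m] a) n = evalC a (n + m) := by
  induction m generalizing a with
  | zero => simp
  | succ m ih =>
    have h1 : φ a = natShift a := by
      change (powersHom (RatFunc ℚ ≃+* RatFunc ℚ) natShift (Multiplicative.ofAdd 1)) a = _
      simp
    rw [Function.iterate_succ_apply, h1]
    filter_upwards [ih (natShift a),
      (tendsto_add_atTop_nat m).eventually (eventually_evalC_natShift a)] with n h2 h3
    rw [h2, h3, add_assoc]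

theorem eventually_opAct_monomial_mul (m : ℕ) (a : RatFunc ℚ) (Q : SkewPolynomial (RatFunc ℚ))
    (u : ℕ → ℂ) :
    ∀ᶠ n in atTop, opAct (monomial m a * Q) u n = evalC a n * opAct Q u (n + m) := by
  induction Q using SkewPolynomial.induction with
  | h0 => simp
  | ha k c q _ _ ih =>
    filter_upwards [ih, eventually_opAct_add (monomial m a * monomial k c) (monomial m a * q) u,
      (tendsto_add_atTop_nat m).eventually (eventually_opAct_add (monomial k c) q u),
      eventually_evalC_mul a (φ^[m] c), eventually_evalC_phi_iterate m c] with n h1 h2 h3 h4 h5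
    rw [mul_add, h2, h1, h3, monomial_mul_monomial, opAct_monomial, opAct_monomial, h4, h5,
      add_assoc]
    ring

/-- Evaluation of coefficients is a ring homomorphism only away from poles, so sequences form a
module over the operators only up to finitely many terms. -/
theorem eventually_opAct_mul (P Q : SkewPolynomial (RatFunc ℚ)) (u : ℕ → ℂ) :
    ∀ᶠ n in atTop, opAct (P * Q) u n = opAct P (opAct Q u) n := by
  induction P using SkewPolynomial.induction with
  | h0 => simp
  | ha m a p _ _ ih =>
    filter_upwards [ih, eventually_opAct_add (monomial m a * Q) (p * Q) u,
      eventually_opAct_add (monomial m a) p (opAct Q u),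
      eventually_opAct_monomial_mul m a Q u] with n h1 h2 h3 h4
    rw [add_mul, h2, h1, h3, h4, opAct_monomial]

theorem coeff_sum_fin_monomial {r : ℕ} (a : Fin r → RatFunc ℚ) (k : ℕ) :
    coeff (∑ i : Fin r, monomial (i : ℕ) (a i)) k = if h : k < r then a ⟨k, h⟩ else 0 := by
  rw [skew_coeff_sum]
  simp only [coeff_monomial]
  split_ifs with h
  · rw [Finset.sum_eq_single ⟨k, h⟩]
    · simp
    · exact fun i _ hi => if_neg fun e => hi (Fin.ext e)
    · simp
  · exact Finset.sum_eq_zero fun i _ => if_neg fun (e : (i : ℕ) = k) => h (e ▸ i.2)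

theorem opAct_sum_fin_monomial {r : ℕ} (a : Fin r → RatFunc ℚ) (u : ℕ → ℂ) (n : ℕ) :
    opAct (∑ i : Fin r, monomial (i : ℕ) (a i)) u n = ∑ i : Fin r, evalC (a i) n * u (n + i) := by
  rw [opAct_eq_sum_range (N := r) fun k hk => by rw [coeff_sum_fin_monomial, dif_neg (by omega)],
    Finset.sum_range]
  exact Finset.sum_congr rfl fun i _ => by rw [coeff_sum_fin_monomial, dif_pos i.2]

theorem eventually_opAct_recOp {r : ℕ} {b : Fin r → RatFunc ℚ} {u : ℕ → ℂ} (hu : Solves b u) :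
    opAct (recOp b) u =ᶠ[atTop] fun _ => 0 := by
  filter_upwards [hu, eventually_opAct_add (monomial r 1) (∑ i : Fin r, monomial (i : ℕ) (b i)) u]
    with n h1 h2
  rw [recOp, h2, opAct_monomial, evalC_one, one_mul, opAct_sum_fin_monomial, h1]

/-- A non-zero operator `∑ a_i S^i` of order less than `r` is injective on the solutions of an
irreducible operator of order `r`, with an inverse that is itself an operator. -/
theorem exists_opAct_inverse {r : ℕ} {b : Fin r → RatFunc ℚ} (hirr : Irreducible (recOp b))
    {a : Fin r → RatFunc ℚ} (ha : a ≠ 0) :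
    ∃ X : SkewPolynomial (RatFunc ℚ), ∀ u : ℕ → ℂ, Solves b u →
      ∀ᶠ n in atTop, u n = opAct X (fun n => ∑ i : Fin r, evalC (a i) n * u (n + i)) n := by
  set A : SkewPolynomial (RatFunc ℚ) := ∑ i : Fin r, monomial (i : ℕ) (a i)
  have hA : A ≠ 0 := by
    intro h0
    refine ha (funext fun i => ?_)
    have := coeff_sum_fin_monomial a i
    rw [dif_pos i.2] at this
    rw [← this]
    change coeff A i = 0
    rw [h0, coeff_zero]
  have hL : ∀ k, (recOp b).coeff k = (if r = k then 1 else 0) + if h : k < r then b ⟨k, h⟩ else 0 :=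
    fun k => by rw [recOp, coeff_add, coeff_sum_fin_monomial, coeff_monomial]
  obtain ⟨X, Y, hXY⟩ := exists_bezout_of_irreducible (r := r) hirr (by simp [hL])
    (fun i hi => by rw [hL, if_neg hi.ne, dif_neg (by omega), add_zero]) hA
    (fun i hi => by rw [coeff_sum_fin_monomial, dif_neg (by omega)])
  refine ⟨X, fun u hu => ?_⟩
  have h1 : ∀ n, opAct 1 u n = u n := fun n => by
    have := opAct_monomial 0 1 u n
    rwa [monomial_zero_one, evalC_one, one_mul, add_zero] at this
  -- Applying `X A + Y L = 1` to `u`, the second term vanishes because `L u = 0`.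
  filter_upwards [eventually_opAct_add (X * A) (Y * recOp b) u, eventually_opAct_mul X A u,
    eventually_opAct_mul Y (recOp b) u, opAct_congr Y (eventually_opAct_recOp hu)] with n h2 h3 h4 h5
  rw [← h1, ← hXY, h2, h3, h4, h5, opAct_zero_right, add_zero]
  congr 1
  exact funext fun n => opAct_sum_fin_monomial a u n

end OperatorAction

/-! ### Perron solutions compatible with a given operator -/

section PerronSystems

open Asymptotics

theorem isBigO_inv_pow_shift {f : ℕ → ℂ} {K : ℕ}
    (hf : f =O[atTop] fun n : ℕ => (n : ℂ)⁻¹ ^ K) (m : ℕ) :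
    (fun n => f (n + m)) =O[atTop] fun n : ℕ => (n : ℂ)⁻¹ ^ K := by
  induction m with
  | zero => simpa using hf
  | succ m ih =>
    refine ((ih.comp_tendsto (tendsto_add_atTop_nat 1)).trans (isBigO_succ_inv_pow K)).congr_left
      fun n => ?_
    simp only [Function.comp_apply]
    congr 1
    omega

theorem tendsto_shift_div {y : ℕ → ℂ} {μ : ℂ} (hy0 : ∀ᶠ n in atTop, y n ≠ 0)
    (hy : Tendsto (fun n => y (n + 1) / y n) atTop (𝓝 μ)) (m : ℕ) :
    Tendsto (fun n => y (n + m) / y n) atTop (𝓝 (μ ^ m)) := by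
  induction m with
  | zero =>
    rw [pow_zero]
    refine tendsto_const_nhds.congr' ?_
    filter_upwards [hy0] with n hn
    rw [Nat.add_zero, div_self hn]
  | succ m ih =>
    rw [pow_succ']
    refine ((hy.comp (tendsto_add_atTop_nat m)).mul ih).congr' ?_
    filter_upwards [(tendsto_add_atTop_nat m).eventually hy0] with n hn
    rw [Function.comp_apply, div_mul_div_cancel₀ hn, add_assoc]

theorem exists_isBigO_evalC (f : RatFunc ℚ) :
    ∃ e : ℕ, evalC f =O[atTop] fun n : ℕ => (n : ℂ) ^ e := by
  obtain ⟨e, he⟩ := exists_hasExpansionTo_evalC f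
  refine ⟨e, (((isBigO_refl (fun n : ℕ => (n : ℂ) ^ e) atTop).mul (he 0).isBigO_one).congr' ?_
    (by simp))⟩
  filter_upwards [eventually_natCast_ne_zero] with n hn
  rw [← mul_assoc, ← mul_pow, mul_inv_cancel₀ hn, one_pow, one_mul]

theorem tendsto_ratio_mul {y s : ℕ → ℂ} {μ : ℂ} (hy : Tendsto (fun n => y (n + 1) / y n) atTop (𝓝 μ))
    (hs : Tendsto (fun n => s (n + 1) / s n) atTop (𝓝 1)) {u : ℕ → ℂ}
    (hu : ∀ᶠ n in atTop, u n = y n * s n) :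
    Tendsto (fun n => u (n + 1) / u n) atTop (𝓝 μ) := by
  have := hy.mul hs
  rw [mul_one] at this
  refine this.congr' ?_
  filter_upwards [hu, (tendsto_add_atTop_nat 1).eventually hu] with n h1 h2
  rw [h1, h2, div_mul_div_comm]

variable {r : ℕ}

theorem PoincarePerron.exists_coeff_limit {b : Fin r → RatFunc ℚ} {lam : Fin r → ℂ}
    (h : PoincarePerron b lam) : ∃ β : Fin r → ℂ,
      (∀ i, Tendsto (fun n : ℕ => evalC (b i) n) atTop (𝓝 (β i))) ∧
      ∀ i, lam i ^ r + ∑ m : Fin r, β m * lam i ^ (m : ℕ) = 0 := by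
  obtain ⟨β, h1, h2, -⟩ := h
  refine ⟨β, h1, fun i => ?_⟩
  have := congrArg (Polynomial.eval (lam i)) h2
  rw [Polynomial.eval_prod, Finset.prod_eq_zero (Finset.mem_univ i) (by simp)] at this
  simpa [Polynomial.eval_finsetSum] using this

theorem exists_hasExpansionTo_sum_evalC_mul (a : Fin r → RatFunc ℚ) {s : Fin r → ℕ → ℂ}
    (hs : ∀ K m, HasExpansionTo K (s m)) :
    ∃ e : ℕ, ∀ K, HasExpansionTo K fun n : ℕ => (n : ℂ)⁻¹ ^ e * ∑ m, evalC (a m) n * s m n := by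
  choose e he using fun m => exists_hasExpansionTo_evalC (a m)
  refine ⟨∑ m, e m, fun K => ?_⟩
  have h1 : ∀ m, HasExpansionTo K fun n : ℕ =>
      (Polynomial.X ^ (∑ m, e m - e m)).eval (n : ℂ)⁻¹ *
        (((n : ℂ)⁻¹ ^ e m * evalC (a m) n) * s m n) := fun m =>
    (hasExpansionTo_eval K _).mul ((he m K).mul (hs K m))
  refine (hasExpansionTo_sum Finset.univ fun m _ => h1 m).congr (Eventually.of_forall fun n => ?_)
  simp only [Finset.mul_sum, Polynomial.eval_pow, Polynomial.eval_X]
  refine Finset.sum_congr rfl fun m _ => ?_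
  have h2 : e m ≤ ∑ m, e m := Finset.single_le_sum (f := e) (fun _ _ => Nat.zero_le _)
    (Finset.mem_univ m)
  rw [← mul_assoc, ← mul_assoc, ← pow_add, Nat.sub_add_cancel h2, mul_assoc]

/-- Here `s(n) = ∑ x_m(n) F(n+m) y(n+m)/y(n)`, with `x_m` of polynomial growth and `y(n+m)/y(n)`
convergent. A flat `F` would give `s → 0`. -/
theorem exists_not_isBigO_of_opAct_inverse {X : SkewPolynomial (RatFunc ℚ)}
    {U V y s F : ℕ → ℂ} {μ : ℂ} (hy0 : ∀ᶠ n in atTop, y n ≠ 0)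
    (hy : Tendsto (fun n => y (n + 1) / y n) atTop (𝓝 μ)) (hs : Tendsto s atTop (𝓝 1))
    (hU : ∀ᶠ n in atTop, U n = y n * s n) (hV : ∀ᶠ n in atTop, V n = y n * F n)
    (hX : ∀ᶠ n in atTop, U n = opAct X V n) :
    ∃ K, ¬ F =O[atTop] fun n : ℕ => (n : ℂ)⁻¹ ^ K := by
  by_contra! hall
  obtain ⟨N, hN⟩ := exists_skew_coeff_eq_zero X
  have h1 : ∀ m ∈ Finset.range N, Tendsto (fun n => evalC (X.coeff m) n * F (n + m) *
      (y (n + m) / y n)) atTop (𝓝 0) := by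
    intro m _
    obtain ⟨k, hk⟩ := exists_isBigO_evalC (X.coeff m)
    refine IsBigO.trans_tendsto ?_ tendsto_natCast_inv
    refine ((hk.mul (isBigO_inv_pow_shift (hall (k + 1)) m)).mul
      ((tendsto_shift_div hy0 hy m).isBigO_one ℂ)).congr' .rfl ?_
    filter_upwards [eventually_natCast_ne_zero] with n hn
    rw [pow_succ, ← mul_assoc, ← mul_pow, mul_inv_cancel₀ hn, one_pow, one_mul, mul_one]
  have h2 : Tendsto s atTop (𝓝 0) := by
    have h3 := tendsto_finsetSum _ h1
    rw [Finset.sum_const_zero] at h3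
    refine h3.congr' ?_
    obtain ⟨M, hM⟩ := eventually_atTop.1 hV
    filter_upwards [hU, hX, hy0, eventually_ge_atTop M] with n h4 h5 h6 h7
    rw [opAct_eq_sum_range hN] at h5
    rw [← mul_right_inj' h6, ← h4, h5, Finset.mul_sum]
    refine Finset.sum_congr rfl fun m _ => ?_
    rw [hM (n + m) (by omega)]
    field_simp
  exact one_ne_zero (tendsto_nhds_unique hs h2)

theorem exists_perron_solution {b : Fin r → RatFunc ℚ} {lam : Fin r → ℂ} (hr : 0 < r)
    (hPP : PoincarePerron b lam) (hb0 : b ⟨0, hr⟩ ≠ 0) (hirr : Irreducible (recOp b))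
    {a : Fin r → RatFunc ℚ} (ha : a ≠ 0) (i : Fin r) :
    ∃ U : ℕ → ℂ, Solves b U ∧ (∀ᶠ n in atTop, U n ≠ 0) ∧
      Tendsto (fun n => U (n + 1) / U n) atTop (𝓝 (lam i)) ∧
      (∀ᶠ n in atTop, ∑ m : Fin r, evalC (a m) n * U (n + m) ≠ 0) ∧
      Tendsto (fun n => (∑ m : Fin r, evalC (a m) (n + 1) * U (n + 1 + m)) /
        ∑ m : Fin r, evalC (a m) n * U (n + m)) atTop (𝓝 (lam i)) := by
  obtain ⟨β, hβ, hroot⟩ := hPP.exists_coeff_limit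
  obtain ⟨-, -, -, hanti⟩ := hPP
  obtain ⟨U, y, t, hy0, hy, ht, hti, ht0, hsol, hU⟩ := exists_split_solution_of_companion hr
    (B := fun n i => evalC (b i) n) hβ (fun K i => hasExpansionTo_evalC_of_tendsto (hβ i) K)
    (eventually_evalC_ne_zero hb0) hroot hanti i
  set s : Fin r → ℕ → ℂ := fun m n => ∑ j, t n j * lam j ^ (m : ℕ)
  have hs : ∀ K m, HasExpansionTo K (s m) := fun K m =>
    hasExpansionTo_sum _ fun j _ => (ht K j).mul (hasExpansionTo_const K _)
  have hs0 : Tendsto (s ⟨0, hr⟩) atTop (𝓝 1) := by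
    have h1 : ∀ j ∈ Finset.univ, Tendsto (fun n => t n j * lam j ^ 0) atTop
        (𝓝 (if j = i then 1 else 0)) := fun j _ => by
      simp only [pow_zero, mul_one]
      split_ifs with h
      · simp [h, hti]
      · exact ht0 j h
    simpa [s] using tendsto_finsetSum _ h1
  have hU0 : ∀ᶠ n in atTop, U n = y n * s ⟨0, hr⟩ n := by
    filter_upwards [hU] with n hn using hn ⟨0, hr⟩
  have hs1 : Tendsto (fun n => s ⟨0, hr⟩ (n + 1) / s ⟨0, hr⟩ n) atTop (𝓝 1) := by
    have := (hs0.comp (tendsto_add_atTop_nat 1)).div hs0 one_ne_zero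
    rwa [div_one] at this
  set F : ℕ → ℂ := fun n => ∑ m : Fin r, evalC (a m) n * s m n
  set V : ℕ → ℂ := fun n => ∑ m : Fin r, evalC (a m) n * U (n + m)
  have hV : ∀ᶠ n in atTop, V n = y n * F n := by
    filter_upwards [hU] with n hn
    simp only [V, F]
    rw [Finset.mul_sum]
    exact Finset.sum_congr rfl fun m _ => by rw [hn m]; ring
  obtain ⟨e, hF⟩ := exists_hasExpansionTo_sum_evalC_mul a hs
  obtain ⟨X, hX⟩ := exists_opAct_inverse hirr ha
  have hF' := exists_not_isBigO_of_opAct_inverse hy0 hy hs0 hU0 hV (hX U hsol)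
  obtain ⟨hF0, hF1⟩ := eventually_ne_zero_and_tendsto_of_hasExpansionTo (f := F) e hF hF'
  have hVr : Tendsto (fun n => V (n + 1) / V n) atTop (𝓝 (lam i)) :=
    tendsto_ratio_mul (s := F) (u := V) hy hF1 hV
  refine ⟨U, hsol, ?_, tendsto_ratio_mul (s := s ⟨0, hr⟩) hy hs1 hU0, ?_, hVr⟩
  · filter_upwards [hU0, hy0, hs0.eventually_ne one_ne_zero] with n h1 h2 h3
    rw [h1]
    exact mul_ne_zero h2 h3
  · filter_upwards [hV, hy0, hF0] with n h1 h2 h3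
    change V n ≠ 0
    rw [h1]
    exact mul_ne_zero h2 h3

end PerronSystems

/-! ### Exponential growth rates -/

section Rates

theorem log_enorm_of_ne_zero {z : ℂ} (hz : z ≠ 0) : ENNReal.log ‖z‖ₑ = (Real.log ‖z‖ : ℝ) := by
  rw [← ofReal_norm, ENNReal.log_ofReal_of_pos (norm_pos_iff.2 hz)]

/-- A sequence with convergent quotients has an exponential growth rate. -/
theorem tendsto_log_enorm_div {w : ℕ → ℂ} {μ : ℂ} (hw0 : ∀ᶠ n in atTop, w n ≠ 0)
    (hw : Tendsto (fun n => w (n + 1) / w n) atTop (𝓝 μ)) :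
    Tendsto (fun n : ℕ => ENNReal.log ‖w n‖ₑ / ((n : ℝ) : EReal)) atTop
      (𝓝 (ENNReal.log ‖μ‖ₑ)) := by
  have hlog : ∀ᶠ n : ℕ in atTop, ((Real.log ‖w n‖ / n : ℝ) : EReal) =
      ENNReal.log ‖w n‖ₑ / ((n : ℝ) : EReal) := by
    filter_upwards [hw0] with n hn
    rw [log_enorm_of_ne_zero hn, EReal.coe_div]
  by_cases hμ : μ = 0
  · rw [hμ, enorm_zero, ENNReal.log_zero, EReal.tendsto_nhds_bot_iff_real]
    intro x
    have h1 : ∀ᶠ n in atTop, ‖w (n + 1) / w n‖ < Real.exp (x - 1) := by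
      have := hw.norm
      rw [hμ, norm_zero] at this
      exact this.eventually (eventually_lt_nhds (Real.exp_pos _))
    obtain ⟨N, hN⟩ := eventually_atTop.1 (h1.and hw0)
    obtain ⟨C, hC⟩ : ∃ C, Real.log ‖w N‖ ≤ N * (x - 1) + C :=
      ⟨Real.log ‖w N‖ - N * (x - 1), by linarith⟩
    have h2 : ∀ n ≥ N, Real.log ‖w n‖ ≤ n * (x - 1) + C := by
      intro n hn
      induction n, hn using Nat.le_induction with
      | base => exact hC
      | succ n hn ih =>
        have h3 := (hN n hn).1
        have h4 : 0 < ‖w n‖ := norm_pos_iff.2 (hN n hn).2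
        have h5 : 0 < ‖w (n + 1)‖ := norm_pos_iff.2 (hN (n + 1) (by omega)).2
        rw [norm_div] at h3
        have h6 := Real.log_lt_log (div_pos h5 h4) h3
        rw [Real.log_exp, Real.log_div h5.ne' h4.ne'] at h6
        push_cast
        linarith
    have h7 : ∀ᶠ n : ℕ in atTop, C < n := tendsto_natCast_atTop_atTop.eventually_gt_atTop C
    filter_upwards [hlog, eventually_ge_atTop N, h7, eventually_gt_atTop 0] with n h8 h9 h10 h11
    rw [← h8, EReal.coe_lt_coe_iff]
    have h12 : (0 : ℝ) < n := by exact_mod_cast h11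
    rw [div_lt_iff₀ h12]
    have := h2 n h9
    linarith
  · rw [log_enorm_of_ne_zero hμ]
    refine Tendsto.congr' hlog ((continuous_coe_real_ereal.tendsto _).comp ?_)
    have h1 : Tendsto (fun n => Real.log ‖w (n + 1)‖ - Real.log ‖w n‖) atTop
        (𝓝 (Real.log ‖μ‖)) := by
      refine (hw.norm.log (norm_ne_zero_iff.2 hμ)).congr' ?_
      filter_upwards [hw0, (tendsto_add_atTop_nat 1).eventually hw0] with n h2 h3
      rw [norm_div, Real.log_div (norm_ne_zero_iff.2 h3) (norm_ne_zero_iff.2 h2)]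
    -- The Cesàro mean of the increments telescopes up to this boundary term. Early zeros of `w` are
    -- harmless, as `Real.log 0 = 0`.
    have h2 : Tendsto (fun n : ℕ => (n : ℝ)⁻¹ * Real.log ‖w 0‖) atTop (𝓝 0) := by
      simpa using (tendsto_inv_atTop_nhds_zero_nat (𝕜 := ℝ)).mul_const (Real.log ‖w 0‖)
    have h3 := h1.cesaro.add h2
    rw [add_zero] at h3
    refine h3.congr fun n => ?_
    rw [Finset.sum_range_sub (fun n => Real.log ‖w n‖), ← mul_add, sub_add_cancel,
      div_eq_inv_mul]

theorem hasConvergenceRate_bot_of_eventually_eq {s : ℕ → ℝ} {l : ℝ}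
    (h : ∀ᶠ n in atTop, s n = l) : HasConvergenceRate s l ⊥ := by
  refine tendsto_const_nhds.congr' ?_
  filter_upwards [h, eventually_gt_atTop 0] with n hn h0
  rw [hn, sub_self, enorm_zero, ENNReal.log_zero, EReal.bot_div_of_pos_ne_top]
  · exact_mod_cast h0
  · exact EReal.coe_ne_top _

theorem hasConvergenceRate_of_ratio {s : ℕ → ℝ} {l : ℝ} {w : ℕ → ℂ} {μ : ℂ}
    (hs : ∀ᶠ n in atTop, (s n : ℂ) - l = w n) (hw0 : ∀ᶠ n in atTop, w n ≠ 0)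
    (hw : Tendsto (fun n => w (n + 1) / w n) atTop (𝓝 μ)) :
    HasConvergenceRate s l (ENNReal.log ‖μ‖ₑ) := by
  refine (tendsto_log_enorm_div hw0 hw).congr' ?_
  filter_upwards [hs] with n hn
  rw [← hn, ← Complex.ofReal_sub, ← ofReal_norm, Complex.norm_real, ofReal_norm]

end Rates

/-! ### Quotients of combinations of a dominated system -/

section Domination

variable {r : ℕ} {lam : Fin r → ℂ} {V : Fin r → ℕ → ℂ}

theorem lam_ne_zero_of_lt (hlam : StrictAnti fun i => ‖lam i‖) {i j : Fin r} (h : j < i) :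
    lam j ≠ 0 :=
  norm_pos_iff.1 ((norm_nonneg _).trans_lt (hlam h))

theorem tendsto_div_of_lt (hlam : StrictAnti fun i => ‖lam i‖)
    (hV0 : ∀ i, ∀ᶠ n in atTop, V i n ≠ 0)
    (hV : ∀ i, Tendsto (fun n => V i (n + 1) / V i n) atTop (𝓝 (lam i))) {i j : Fin r}
    (h : j < i) : Tendsto (fun n => V i n / V j n) atTop (𝓝 0) := by
  have hj := lam_ne_zero_of_lt hlam h
  have hlt : ‖lam i / lam j‖ < 1 := by
    rw [norm_div, div_lt_one (norm_pos_iff.2 hj)]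
    exact hlam h
  refine (summable_of_ratio_test_tendsto_lt_one hlt ?_ ?_).tendsto_atTop_zero
  · filter_upwards [hV0 i, hV0 j] with n h1 h2 using div_ne_zero h1 h2
  · refine ((hV i).div (hV j) hj).norm.congr fun n => ?_
    rw [← norm_div, Pi.div_apply, div_div_div_comm]

theorem tendsto_sum_div (hlam : StrictAnti fun i => ‖lam i‖)
    (hV0 : ∀ i, ∀ᶠ n in atTop, V i n ≠ 0)
    (hV : ∀ i, Tendsto (fun n => V i (n + 1) / V i n) atTop (𝓝 (lam i))) {c : Fin r → ℂ}
    {j : Fin r} (hc : ∀ i < j, c i = 0) :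
    Tendsto (fun n => (∑ i, c i * V i n) / V j n) atTop (𝓝 (c j)) := by
  have h1 : ∀ i ∈ Finset.univ, Tendsto (fun n => c i * (V i n / V j n)) atTop
      (𝓝 (if i = j then c j else 0)) := by
    intro i _
    split_ifs with h
    · subst h
      refine tendsto_const_nhds.congr' ?_
      filter_upwards [hV0 i] with n hn
      rw [div_self hn, mul_one]
    · rcases lt_or_gt_of_ne h with h | h
      · simp [hc i h]
      · simpa using (tendsto_div_of_lt hlam hV0 hV h).const_mul (c i)
  have h2 := tendsto_finsetSum _ h1
  rw [Finset.sum_ite_eq' Finset.univ j, if_pos (Finset.mem_univ j)] at h2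
  refine h2.congr fun n => ?_
  rw [Finset.sum_div]
  exact Finset.sum_congr rfl fun i _ => by rw [mul_div_assoc]

theorem eventually_sum_ne_zero (hlam : StrictAnti fun i => ‖lam i‖)
    (hV0 : ∀ i, ∀ᶠ n in atTop, V i n ≠ 0)
    (hV : ∀ i, Tendsto (fun n => V i (n + 1) / V i n) atTop (𝓝 (lam i))) {c : Fin r → ℂ}
    {j : Fin r} (hc : IsFirstNonzero c j) : ∀ᶠ n in atTop, ∑ i, c i * V i n ≠ 0 := by
  filter_upwards [(tendsto_sum_div hlam hV0 hV hc.2).eventually_ne hc.1] with n hn h0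
  rw [h0, zero_div] at hn
  exact hn rfl

theorem tendsto_sum_ratio (hlam : StrictAnti fun i => ‖lam i‖)
    (hV0 : ∀ i, ∀ᶠ n in atTop, V i n ≠ 0)
    (hV : ∀ i, Tendsto (fun n => V i (n + 1) / V i n) atTop (𝓝 (lam i))) {c : Fin r → ℂ}
    {j : Fin r} (hc : IsFirstNonzero c j) :
    Tendsto (fun n => (∑ i, c i * V i (n + 1)) / ∑ i, c i * V i n) atTop (𝓝 (lam j)) := by
  have h1 := tendsto_sum_div hlam hV0 hV hc.2
  have h2 : Tendsto (fun n => ((∑ i, c i * V i (n + 1)) / V j (n + 1)) /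
      ((∑ i, c i * V i n) / V j n)) atTop (𝓝 1) := by
    have := (h1.comp (tendsto_add_atTop_nat 1)).div h1 hc.1
    rwa [div_self hc.1] at this
  refine tendsto_ratio_mul (s := fun n => (∑ i, c i * V i n) / V j n) (hV j) h2
    (u := fun n => ∑ i, c i * V i n) ?_
  filter_upwards [hV0 j] with n hn
  rw [mul_div_cancel₀ _ hn]

theorem exists_isFirstNonzero {c : Fin r → ℂ} (hc : c ≠ 0) : ∃ j, IsFirstNonzero c j := by
  obtain ⟨i, hi⟩ := Function.ne_iff.1 hc
  obtain ⟨j, hj, hmin⟩ := WellFounded.has_min (wellFounded_lt (α := Fin r)) {i | c i ≠ 0} ⟨i, hi⟩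
  exact ⟨j, hj, fun k hk => by_contra fun h => hmin k h hk⟩

/-- If a quotient of two combinations of a dominated system converges, its limit is the quotient
of the leading coefficients. -/
theorem exists_leading_of_tendsto (hlam : StrictAnti fun i => ‖lam i‖)
    (hV0 : ∀ i, ∀ᶠ n in atTop, V i n ≠ 0)
    (hV : ∀ i, Tendsto (fun n => V i (n + 1) / V i n) atTop (𝓝 (lam i))) {c c' : Fin r → ℂ}
    {u u' : ℕ → ℂ} {l : ℂ} (hu : IsExpansion V u c) (hu' : IsExpansion V u' c')
    (hne : ∀ᶠ n in atTop, u' n ≠ 0) (hl : Tendsto (fun n => u n / u' n) atTop (𝓝 l)) :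
    ∃ j, IsFirstNonzero c' j ∧ (∀ i < j, c i = 0) ∧ l = c j / c' j := by
  have hc' : c' ≠ 0 := by
    rintro rfl
    obtain ⟨n, h1, h2⟩ := (hne.and hu').exists
    simp [h1] at h2
  obtain ⟨j, hj⟩ := exists_isFirstNonzero hc'
  -- Both `u / V_i` and `u' / V_i` converge, to `c_i` and `c'_i`. If `c` had its first non-zero
  -- entry before `j`, this would read `l * 0 = c_i`.
  have hdiv : ∀ i ≤ j, (∀ k < i, c k = 0) → l * c' i = c i := by
    intro i hi hci
    have h1 := tendsto_sum_div hlam hV0 hV hci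
    have h2 := tendsto_sum_div hlam hV0 hV (c := c') (j := i) fun k hk => hj.2 k (hk.trans_le hi)
    refine tendsto_nhds_unique ((hl.mul h2).congr' ?_) h1
    filter_upwards [hne, hu, hu'] with n h3 h4 h5
    rw [← h4, ← h5, div_mul_div_cancel₀ h3]
  have hcj : ∀ i < j, c i = 0 := by
    by_contra! h
    obtain ⟨i, hi, hci⟩ := h
    obtain ⟨k, hk⟩ := exists_isFirstNonzero (c := c) fun h0 => hci (by rw [h0]; rfl)
    have hki : k < j := lt_of_le_of_lt (not_lt.1 fun h1 => hci (hk.2 i h1)) hi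
    have := hdiv k hki.le hk.2
    rw [hj.2 k hki, mul_zero] at this
    exact hk.1 this.symm
  exact ⟨j, hj, hcj, (eq_div_iff hj.1).2 (hdiv j le_rfl hcj)⟩

/-- Limit and convergence rate of a quotient of two combinations of a dominated system. -/
theorem convergence_of_leading (hlam : StrictAnti fun i => ‖lam i‖)
    (hV0 : ∀ i, ∀ᶠ n in atTop, V i n ≠ 0)
    (hV : ∀ i, Tendsto (fun n => V i (n + 1) / V i n) atTop (𝓝 (lam i))) {c c' : Fin r → ℂ}
    {u u' : ℕ → ℂ} {l : ℝ} (hu : IsExpansion V u c) (hu' : IsExpansion V u' c') {s : ℕ → ℝ}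
    (hs : ∀ᶠ n in atTop, (s n : ℂ) = u n / u' n) {j : Fin r} (hj : IsFirstNonzero c' j)
    (hcj : ∀ i < j, c i = 0) (hl : (l : ℂ) = c j / c' j) :
    (∀ᶠ n in atTop, u' n ≠ 0) ∧ Tendsto s atTop (𝓝 l) ∧
      (∀ k, IsFirstNonzero (fun i => c' j * c i - c j * c' i) k →
        j < k ∧ HasConvergenceRate s l (ENNReal.log ‖lam k / lam j‖ₑ)) ∧
      ((∀ i, c' j * c i - c j * c' i = 0) → HasConvergenceRate s l ⊥) := by
  have hne : ∀ᶠ n in atTop, u' n ≠ 0 := by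
    filter_upwards [hu', eventually_sum_ne_zero hlam hV0 hV hj] with n h1 h2
    rwa [h1]
  set d : Fin r → ℂ := fun i => c' j * c i - c j * c' i
  -- The error is again a quotient of combinations, with numerator coefficients `d_i`. These vanish
  -- for `i ≤ j`, and the first non-zero one determines the rate.
  have hdiff : ∀ᶠ n in atTop, (s n : ℂ) - l =
      (∑ i, d i * V i n) / (c' j * ∑ i, c' i * V i n) := by
    filter_upwards [hs, hu, hu', hne] with n h1 h2 h3 h4
    have h5 : ∑ i, d i * V i n = c' j * u n - c j * u' n := by
      rw [h2, h3, Finset.mul_sum, Finset.mul_sum, ← Finset.sum_sub_distrib]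
      exact Finset.sum_congr rfl fun i _ => by simp only [d]; ring
    have h6 := hj.1
    rw [h5, ← h3, h1, hl]
    field_simp
  refine ⟨hne, ?_, fun k hk => ?_, fun h0 => ?_⟩
  · have h1 := (tendsto_sum_div hlam hV0 hV hcj).div (tendsto_sum_div hlam hV0 hV hj.2) hj.1
    rw [← hl] at h1
    have h2 : Tendsto (fun n => (s n : ℂ)) atTop (𝓝 (l : ℂ)) := by
      refine h1.congr' ?_
      filter_upwards [hs, hu, hu', hV0 j] with n h3 h4 h5 h6
      rw [Pi.div_apply, h3, ← h4, ← h5, div_div_div_cancel_right₀ h6]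
    exact tendsto_ofReal_iff.1 h2
  · have hjk : j < k := by
      by_contra! h
      refine hk.1 ?_
      rcases h.eq_or_lt with rfl | h
      · ring
      · change c' j * c k - c j * c' k = 0
        rw [hcj k h, hj.2 k h]
        ring
    refine ⟨hjk, hasConvergenceRate_of_ratio hdiff ?_ ?_⟩
    · filter_upwards [eventually_sum_ne_zero hlam hV0 hV hk,
        eventually_sum_ne_zero hlam hV0 hV hj] with n h1 h2
      exact div_ne_zero h1 (mul_ne_zero hj.1 h2)
    · refine ((tendsto_sum_ratio hlam hV0 hV hk).div (tendsto_sum_ratio hlam hV0 hV hj)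
        (lam_ne_zero_of_lt hlam hjk)).congr fun n => ?_
      rw [Pi.div_apply]
      conv_rhs => rw [div_div_div_comm, mul_div_mul_left _ _ hj.1]
  · refine hasConvergenceRate_bot_of_eventually_eq ?_
    filter_upwards [hdiff] with n hn
    have h1 : ∀ i, d i = 0 := h0
    simp only [h1, zero_mul, Finset.sum_const_zero, zero_div] at hn
    exact_mod_cast sub_eq_zero.1 hn

end Domination

/-! ### Expansion of solutions in a Perron system -/

section Casoratian

variable {r : ℕ} {b : Fin r → RatFunc ℚ}

theorem eq_zero_of_recurrence {B : ℕ → Fin r → ℂ} {u : ℕ → ℂ} {N : ℕ}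
    (hrec : ∀ n ≥ N, u (n + r) + ∑ i : Fin r, B n i * u (n + i) = 0)
    (h0 : ∀ m : Fin r, u (N + m) = 0) : ∀ n ≥ N, u n = 0 := by
  intro n
  induction n using Nat.strong_induction_on with
  | _ n ih =>
    intro hn
    by_cases h : n < N + r
    · have := h0 ⟨n - N, by omega⟩
      simpa [Nat.add_sub_cancel' hn] using this
    · have h1 := hrec (n - r) (by omega)
      rw [Finset.sum_eq_zero fun i _ => by rw [ih (n - r + i) (by omega) (by omega), mul_zero],
        Nat.sub_add_cancel (by omega), add_zero] at h1
      exact h1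

theorem IsPerronSystem.exists_expansion {lam : Fin r → ℂ} (hlam : StrictAnti fun i => ‖lam i‖)
    {U : Fin r → ℕ → ℂ} (hU : IsPerronSystem b lam U) {u : ℕ → ℂ} (hu : Solves b u) :
    ∃ c, IsExpansion U u c := by
  obtain ⟨N, hN⟩ := eventually_atTop.1 ((eventually_all.2 hU.solves).and hu)
  have hsum : ∀ (c : Fin r → ℂ), ∀ n ≥ N, ∑ i, c i * U i (n + r) +
      ∑ m : Fin r, evalC (b m) n * ∑ i, c i * U i (n + m) = 0 := by
    intro c n hn
    have h1 : ∑ m : Fin r, evalC (b m) n * ∑ i, c i * U i (n + m) =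
        ∑ i, c i * ∑ m : Fin r, evalC (b m) n * U i (n + m) := by
      simp only [Finset.mul_sum]
      rw [Finset.sum_comm]
      exact Finset.sum_congr rfl fun i _ => Finset.sum_congr rfl fun m _ => by ring
    rw [h1, ← Finset.sum_add_distrib]
    exact Finset.sum_eq_zero fun i _ => by rw [← mul_add, (hN n hn).1 i, mul_zero]
  set W : Matrix (Fin r) (Fin r) ℂ := Matrix.of fun i m => U i (N + m)
  have hvec : ∀ (c : Fin r → ℂ) (m : Fin r), (c ᵥ* W) m = ∑ i, c i * U i (N + m) :=
    fun _ _ => rfl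
  -- A relation between the rows of the Casoratian matrix propagates by the recurrence to all `n ≥
  -- N`, but a non-trivial combination is eventually non-zero by domination.
  have hdet : W.det ≠ 0 := by
    intro h0
    obtain ⟨c, hc, hcW⟩ := Matrix.exists_vecMul_eq_zero_iff.2 h0
    obtain ⟨j, hj⟩ := exists_isFirstNonzero hc
    have h1 := eq_zero_of_recurrence (u := fun n => ∑ i, c i * U i n) (hsum c)
      fun m => by rw [← hvec, hcW]; rfl
    obtain ⟨n, h2, h3⟩ := ((eventually_sum_ne_zero hlam hU.ne_zero hU.ratio hj).and
      (eventually_ge_atTop N)).exists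
    exact h2 (h1 n h3)
  refine ⟨(fun m : Fin r => u (N + m)) ᵥ* W⁻¹, eventually_atTop.2 ⟨N, fun n hn => ?_⟩⟩
  set c := (fun m : Fin r => u (N + m)) ᵥ* W⁻¹
  have hcW : c ᵥ* W = fun m : Fin r => u (N + m) := by
    rw [Matrix.vecMul_vecMul, Matrix.nonsing_inv_mul _ hdet.isUnit, Matrix.vecMul_one]
  refine sub_eq_zero.1 (eq_zero_of_recurrence (B := fun n i => evalC (b i) n)
    (u := fun n => u n - ∑ i, c i * U i n) (fun n hn => ?_) (fun m => ?_) n hn)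
  · have h1 := hsum c n hn
    have h2 := (hN n hn).2
    simp only [mul_sub, Finset.sum_sub_distrib]
    linear_combination h2 - h1
  · rw [← hvec, hcW, sub_self]

end Casoratian

/-! ### Values of rational functions at points and along lines -/

section PointEvaluation

variable {d : ℕ}

theorem mul_ratDen (f : RatField d) :
    f * algebraMap _ (RatField d) (ratDen f) = algebraMap _ (RatField d) (ratNum f) := by
  have hden : algebraMap (MvPolynomial (Fin d) ℚ) (RatField d) (ratDen f) ≠ 0 :=
    IsFractionRing.to_map_ne_zero_of_mem_nonZeroDivisors
      (IsFractionRing.den (MvPolynomial (Fin d) ℚ) f).2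
  rw [← eq_div_iff hden]
  exact (IsFractionRing.mk'_num_den' (MvPolynomial (Fin d) ℚ) f).symm

/-- The reduced denominator divides every other denominator, so any fraction with denominator
non-zero at `x` computes the value. -/
theorem definedAt_and_evalAt_of_mul_eq {f : RatField d} {x : Fin d → ℚ}
    {p q : MvPolynomial (Fin d) ℚ} (hq : MvPolynomial.eval x q ≠ 0)
    (h : f * algebraMap _ (RatField d) q = algebraMap _ (RatField d) p) :
    DefinedAt f x ∧ evalAt f x = MvPolynomial.eval x p / MvPolynomial.eval x q := by
  have h1 : ratNum f * q = p * ratDen f := by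
    apply IsFractionRing.injective (MvPolynomial (Fin d) ℚ) (RatField d)
    rw [map_mul, map_mul, ← h, ← mul_ratDen f]
    ring
  have hrel : IsRelPrime (ratDen f) (ratNum f) :=
    (IsFractionRing.num_den_reduced (MvPolynomial (Fin d) ℚ) f).symm
  have h2 : ratDen f ∣ q := hrel.dvd_of_dvd_mul_left ⟨p, by rw [h1, mul_comm]⟩
  have h3 : MvPolynomial.eval x (ratDen f) ≠ 0 := by
    obtain ⟨e, rfl⟩ := h2
    rw [map_mul] at hq
    exact left_ne_zero_of_mul hq
  refine ⟨h3, ?_⟩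
  rw [evalAt, div_eq_div_iff h3 hq, ← map_mul, ← map_mul, h1]

theorem definedAt_and_evalAt_mul {f g : RatField d} {x : Fin d → ℚ} (hf : DefinedAt f x)
    (hg : DefinedAt g x) : DefinedAt (f * g) x ∧ evalAt (f * g) x = evalAt f x * evalAt g x := by
  have := definedAt_and_evalAt_of_mul_eq (f := f * g) (x := x) (p := ratNum f * ratNum g)
    (q := ratDen f * ratDen g) (by rw [map_mul]; exact mul_ne_zero hf hg)
    (by rw [map_mul, map_mul, ← mul_ratDen f, ← mul_ratDen g]; ring)
  refine ⟨this.1, ?_⟩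
  rw [this.2, map_mul, map_mul, evalAt, evalAt, div_mul_div_comm]

theorem definedAt_and_evalAt_add {f g : RatField d} {x : Fin d → ℚ} (hf : DefinedAt f x)
    (hg : DefinedAt g x) : DefinedAt (f + g) x ∧ evalAt (f + g) x = evalAt f x + evalAt g x := by
  have := definedAt_and_evalAt_of_mul_eq (f := f + g) (x := x)
    (p := ratNum f * ratDen g + ratDen f * ratNum g)
    (q := ratDen f * ratDen g) (by rw [map_mul]; exact mul_ne_zero hf hg)
    (by rw [map_mul, map_add, map_mul, map_mul, ← mul_ratDen f, ← mul_ratDen g]; ring)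
  refine ⟨this.1, ?_⟩
  rw [this.2, map_mul, map_add, map_mul, map_mul, evalAt, evalAt, div_add_div _ _ hf hg]

theorem definedAt_and_evalAt_sum {ι : Type*} (s : Finset ι) {f : ι → RatField d} {x : Fin d → ℚ}
    (hf : ∀ i ∈ s, DefinedAt (f i) x) :
    DefinedAt (∑ i ∈ s, f i) x ∧ evalAt (∑ i ∈ s, f i) x = ∑ i ∈ s, evalAt (f i) x := by
  classical
  induction s using Finset.induction_on with
  | empty =>
    have := definedAt_and_evalAt_of_mul_eq (f := (0 : RatField d)) (x := x) (p := 0) (q := 1)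
      (by simp) (by simp)
    simpa using this
  | insert a s ha ih =>
    have h1 := ih fun i hi => hf i (by simp [hi])
    have h2 := definedAt_and_evalAt_add (hf a (by simp)) h1.1
    rw [Finset.sum_insert ha, Finset.sum_insert ha, h2.2, h1.2]
    exact ⟨h2.1, rfl⟩

theorem eval_polyShift (w : Fin d → ℤ) (x : Fin d → ℚ) (p : MvPolynomial (Fin d) ℚ) :
    MvPolynomial.eval x (polyShift w p) = MvPolynomial.eval (fun i => x i + w i) p := by
  have : (MvPolynomial.aeval x).comp (polyShift w : MvPolynomial (Fin d) ℚ →ₐ[ℚ] _) =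
      MvPolynomial.aeval fun i => x i + (w i : ℚ) := by
    ext i
    simp [polyShift]
  simpa [MvPolynomial.aeval_eq_eval] using DFunLike.congr_fun this p

theorem definedAt_and_evalAt_shift {f : RatField d} {x : Fin d → ℚ} {w : Fin d → ℤ}
    (hf : DefinedAt f fun i => x i + w i) :
    DefinedAt (shift w f) x ∧ evalAt (shift w f) x = evalAt f fun i => x i + w i := by
  have hmap : ∀ p : MvPolynomial (Fin d) ℚ, shift w (algebraMap _ (RatField d) p) =
      algebraMap _ (RatField d) (polyShift w p) := fun p =>
    IsFractionRing.ringEquivOfRingEquiv_algebraMap _ p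
  have := definedAt_and_evalAt_of_mul_eq (f := shift w f) (x := x) (p := polyShift w (ratNum f))
    (q := polyShift w (ratDen f)) (by rw [eval_polyShift]; exact hf)
    (by rw [← hmap, ← hmap, ← map_mul, mul_ratDen])
  refine ⟨this.1, ?_⟩
  rw [this.2, eval_polyShift, eval_polyShift, evalAt]

theorem eval_polyOnLine (x : Fin d → ℚ) (v : Fin d → ℤ) (g : MvPolynomial (Fin d) ℚ) (n : ℕ) :
    (polyOnLine x v g).eval (n : ℚ) =
      MvPolynomial.eval (fun i => x i + ((n • v) i : ℤ)) g := by
  have : (Polynomial.aeval (n : ℚ)).comp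
      (MvPolynomial.aeval fun i => Polynomial.C (x i) + Polynomial.C (v i : ℚ) * Polynomial.X) =
      (MvPolynomial.aeval fun i => x i + (((n • v) i : ℤ) : ℚ) :
        MvPolynomial (Fin d) ℚ →ₐ[ℚ] ℚ) := by
    ext i
    simp [mul_comm]
  simpa [MvPolynomial.aeval_eq_eval, polyOnLine, Polynomial.aeval_def,
    Polynomial.eval₂_eq_eval_map] using DFunLike.congr_fun this g

theorem IsRestriction.eventually_evalC {x : Fin d → ℚ} {v : Fin d → ℤ} {f : RatField d}
    {g : RatFunc ℚ} (h : IsRestriction x v f g) :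
    ∀ᶠ n : ℕ in atTop, DefinedAt f (fun i => x i + ((n • v) i : ℤ)) ∧
      evalC g n = ((evalAt f fun i => x i + ((n • v) i : ℤ) : ℚ) : ℂ) := by
  filter_upwards [eventually_eval₂_ne_zero h.1] with n hn
  have h1 : (polyOnLine x v (ratDen f)).eval (n : ℚ) ≠ 0 := by
    intro h0
    refine hn ?_
    rw [Polynomial.eval₂_at_natCast, h0, map_zero]
  refine ⟨?_, ?_⟩
  · rwa [eval_polyOnLine] at h1
  · rw [evalC_eq_cast, h.2, ratFunc_eval_div _ _ _ h1]
    change (((polyOnLine x v (ratNum f)).eval (n : ℚ) /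
      (polyOnLine x v (ratDen f)).eval (n : ℚ) : ℚ) : ℂ) = _
    rw [eval_polyOnLine, eval_polyOnLine]
    rfl

end PointEvaluation

/-! ### From the matrix field to the recurrence -/

section Trajectories

variable {d r : ℕ} {M : CMF d r} {x : Fin d → ℚ} {v : Fin d → ℤ}

/-- The cocycle identity for `(n+1)v = nv + v`, evaluated at `x`, where the shifted factor becomes
`M_v(x + nv) = T(n)`. -/
theorem CMF.eventually_evalMat_succ (hdef : ∀ᶠ n : ℕ in atTop, M.EvalDefined x (n • v))
    {T : GL (Fin r) (RatFunc ℚ)} (hT : M.IsTrajectoryMatrix x v T) :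
    ∀ᶠ n : ℕ in atTop, ∀ i j, ((M.evalMat x ((n + 1) • v) i j : ℚ) : ℂ) =
      ∑ k, (M.evalMat x (n • v) i k : ℂ) * evalC (T.val k j) n := by
  have h := eventually_all.2 fun i => eventually_all.2 fun j => (hT i j).eventually_evalC
  filter_upwards [hdef, h] with n h1 h2 i j
  have h3 : (M.mat ((n + 1) • v)).val i j =
      ∑ k, (M.mat (n • v)).val i k * shift (n • v) ((M.mat v).val k j) := by
    rw [succ_nsmul, M.cocycle]
    rfl
  have h4 := fun k => definedAt_and_evalAt_shift (h2 k j).1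
  have h5 := fun k => definedAt_and_evalAt_mul (h1 i k) (h4 k).1
  rw [CMF.evalMat, Matrix.of_apply, h3, (definedAt_and_evalAt_sum _ fun k _ => (h5 k).1).2]
  push_cast
  refine Finset.sum_congr rfl fun k _ => ?_
  rw [(h5 k).2, (h4 k).2, (h2 k j).2]
  push_cast
  rfl

theorem eventually_evalC_companionMatrix (b : Fin r → RatFunc ℚ) :
    ∀ᶠ n : ℕ in atTop, ∀ i j, evalC (companionMatrix b i j) n =
      companionMatrix (fun i => evalC (b i) n) i j := by
  filter_upwards [eventually_all.2 fun i => eventually_evalC_add (b i) (- b i)] with n hn i j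
  simp only [companionMatrix, Matrix.of_apply]
  split_ifs
  · have := hn i
    rw [add_neg_cancel, evalC_zero] at this
    linear_combination - this
  · exact evalC_one n
  · exact evalC_zero n

/-- The sequence `pᵗ M_{nv}(x) e_1` solves the recurrence encoded by the trajectory matrix, and
determines all pairings with `p`. -/
theorem CMF.pairing_eFirst (hr : 0 < r) (hdef : ∀ᶠ n : ℕ in atTop, M.EvalDefined x (n • v))
    {T : GL (Fin r) (RatFunc ℚ)} (hT : M.IsTrajectoryMatrix x v T)
    {b : Fin r → RatFunc ℚ} (hcomp : T.val = companionMatrix b) (p : Fin r → ℚ) :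
    Solves b (fun n => (M.pairing x v p (eFirst r) n : ℂ)) ∧
    (∀ᶠ n in atTop, (M.pairing x v p (eLast r) n : ℂ) =
      M.pairing x v p (eFirst r) (n + (r - 1))) ∧
    ∀ a : Fin r → RatFunc ℚ, ∀ᶠ n in atTop, (M.pairing x v p (evalVec a n) n : ℂ) =
      ∑ m : Fin r, evalC (a m) n * M.pairing x v p (eFirst r) (n + m) := by
  set w : ℕ → Fin r → ℂ := fun n m => (((p ᵥ* M.evalMat x (n • v)) m : ℚ) : ℂ)
  have hpair : ∀ (p' : Fin r → ℚ) n, (M.pairing x v p p' n : ℂ) = ∑ m, w n m * p' m := by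
    intro p' n
    rw [CMF.pairing, Matrix.dotProduct_mulVec, dotProduct]
    push_cast
    rfl
  have hw : ∀ᶠ n in atTop, w (n + 1) = w n ᵥ* companionMatrix (fun i => evalC (b i) n) := by
    filter_upwards [CMF.eventually_evalMat_succ hdef hT, eventually_evalC_companionMatrix b]
      with n h1 h2
    funext m
    simp only [w, vecMul, dotProduct]
    push_cast
    simp only [h1, hcomp, h2, Finset.mul_sum, Finset.sum_mul]
    rw [Finset.sum_comm]
    exact Finset.sum_congr rfl fun i _ => Finset.sum_congr rfl fun k _ => by ring
  obtain ⟨h1, h2⟩ := vecMul_companionMatrix_shift hr hw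
  have hfirst : ∀ n, (M.pairing x v p (eFirst r) n : ℂ) = w n ⟨0, hr⟩ := by
    intro n
    rw [hpair, Finset.sum_eq_single ⟨0, hr⟩]
    · simp [eFirst]
    · intro m _ hm
      have : (m : ℕ) ≠ 0 := fun e => hm (Fin.ext e)
      simp [eFirst, this]
    · simp
  simp only [hfirst]
  refine ⟨h2, ?_, fun a => ?_⟩
  · filter_upwards [h1] with n hn
    rw [hpair, ← hn ⟨r - 1, by omega⟩, Finset.sum_eq_single ⟨r - 1, by omega⟩]
    · simp [eLast, Nat.sub_add_cancel hr]
    · intro m _ hm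
      have : (m : ℕ) + 1 ≠ r := fun e => hm (Fin.ext (by simp; omega))
      simp [eLast, this]
    · simp
  · filter_upwards [h1] with n hn
    rw [hpair]
    refine Finset.sum_congr rfl fun m _ => ?_
    rw [← hn m, evalC_eq_cast, mul_comm]
    rfl

end Trajectories

/-! ### Transfer of coefficients and rates to the two ratios -/

section Conclusion

variable {r : ℕ} {b : Fin r → RatFunc ℚ} {lam : Fin r → ℂ}

theorem IsExpansion.shift {U : Fin r → ℕ → ℂ} {u : ℕ → ℂ} {c : Fin r → ℂ}
    (h : IsExpansion U u c) (k : ℕ) :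
    IsExpansion (fun i n => U i (n + k)) (fun n => u (n + k)) c :=
  (tendsto_add_atTop_nat k).eventually h

theorem IsExpansion.operator {U : Fin r → ℕ → ℂ} {u : ℕ → ℂ} {c : Fin r → ℂ}
    (h : IsExpansion U u c) (a : Fin r → RatFunc ℚ) :
    IsExpansion (fun i n => ∑ m : Fin r, evalC (a m) n * U i (n + m))
      (fun n => ∑ m : Fin r, evalC (a m) n * u (n + m)) c := by
  obtain ⟨N, hN⟩ := eventually_atTop.1 h
  filter_upwards [eventually_ge_atTop N] with n hn
  simp only [Finset.mul_sum]
  rw [Finset.sum_comm]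
  refine Finset.sum_congr rfl fun m _ => ?_
  rw [hN (n + m) (by omega), Finset.mul_sum]
  exact Finset.sum_congr rfl fun i _ => by ring

/-- The shift `k` will be `r - 1`, as pairing with `e_r` reads the last entry of the window.
Shifting changes neither the coefficients nor the limits of the quotients. -/
theorem IsPerronSystem.exists_leading (hlam : StrictAnti fun i => ‖lam i‖) {U : Fin r → ℕ → ℂ}
    (hU : IsPerronSystem b lam U) {u u' : ℕ → ℂ} (hu : Solves b u) (hu' : Solves b u') {s : ℕ → ℝ}
    {l : ℝ} {k : ℕ} (hs : ∀ᶠ n in atTop, (s n : ℂ) = u (n + k) / u' (n + k))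
    (hne : ∀ᶠ n in atTop, u' (n + k) ≠ 0) (hl : Tendsto s atTop (𝓝 l)) :
    ∃ c c' : Fin r → ℂ, IsExpansion U u c ∧ IsExpansion U u' c' ∧
      ∃ j, IsFirstNonzero c' j ∧ (∀ i < j, c i = 0) ∧ (l : ℂ) = c j / c' j ∧
        (∀ k, IsFirstNonzero (fun i => c' j * c i - c j * c' i) k →
          j < k ∧ HasConvergenceRate s l (ENNReal.log ‖lam k / lam j‖ₑ)) ∧
        ((∀ i, c' j * c i - c j * c' i = 0) → HasConvergenceRate s l ⊥) := by
  obtain ⟨c, hc⟩ := hU.exists_expansion hlam hu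
  obtain ⟨c', hc'⟩ := hU.exists_expansion hlam hu'
  have hV0 : ∀ i, ∀ᶠ n in atTop, U i (n + k) ≠ 0 := fun i =>
    (tendsto_add_atTop_nat k).eventually (hU.ne_zero i)
  have hV : ∀ i, Tendsto (fun n => U i (n + 1 + k) / U i (n + k)) atTop (𝓝 (lam i)) := fun i =>
    ((hU.ratio i).comp (tendsto_add_atTop_nat k)).congr fun n => by
      rw [Function.comp_apply, add_right_comm]
  have hl' : Tendsto (fun n => u (n + k) / u' (n + k)) atTop (𝓝 (l : ℂ)) :=
    (tendsto_ofReal_iff.2 hl).congr' hs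
  obtain ⟨j, hj, hcj, hlj⟩ := exists_leading_of_tendsto (V := fun i n => U i (n + k)) hlam hV0 hV
    (hc.shift k) (hc'.shift k) hne hl'
  obtain ⟨-, -, h1, h2⟩ := convergence_of_leading (V := fun i n => U i (n + k)) hlam hV0 hV
    (hc.shift k) (hc'.shift k) hs hj hcj hlj
  exact ⟨c, c', hc, hc', j, hj, hcj, hlj, h1, h2⟩

theorem pos_of_irreducible_recOp (hirr : Irreducible (recOp b)) : 0 < r := by
  rcases Nat.eq_zero_or_pos r with rfl | h
  · refine (hirr.not_isUnit ?_).elim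
    have : recOp b = 1 := by simp [recOp, SkewPolynomial.C_1]
    rw [this]
    exact isUnit_one
  · exact h

theorem companionMatrix_coeff_ne_zero {K : Type*} [Field K] {b : Fin r → K} (hr : 0 < r)
    {T : GL (Fin r) K} (hT : T.val = companionMatrix b) : b ⟨0, hr⟩ ≠ 0 := by
  intro h0
  have hdet : T.val.det ≠ 0 := ((Matrix.isUnit_iff_isUnit_det _).1 T.isUnit).ne_zero
  refine hdet (Matrix.det_eq_zero_of_row_eq_zero ⟨0, hr⟩ fun j => ?_)
  rw [hT]
  simp [companionMatrix, h0]

end Conclusion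

end Companion

end

theorem mainTheorem8 {d r : ℕ} (M : Companion.CMF d r) (x : Fin d → ℚ) (v : Fin d → ℤ)
    (hdef : ∀ᶠ n : ℕ in atTop, M.EvalDefined x (n • v))
    (T : GL (Fin r) (RatFunc ℚ)) (hT : M.IsTrajectoryMatrix x v T)
    (b : Fin r → RatFunc ℚ) (hcomp : T.val = Companion.companionMatrix b)
    (lam : Fin r → ℂ) (hPP : Companion.PoincarePerron b lam)
    (hirr : Irreducible (Companion.recOp b)) :
    (∃ U : Fin r → ℕ → ℂ, Companion.IsPerronSystem b lam U) ∧
    ∀ a : Fin r → RatFunc ℚ, a ≠ 0 →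
    ∀ (p q : Fin r → ℚ) (l : ℝ),
      M.RatioConverges x v p (fun _ => Companion.eLast r) q (fun _ => Companion.eLast r) l →
      M.RatioConverges x v p (Companion.evalVec a) q (Companion.evalVec a) l ∧
      ∃ ρ : EReal,
        Companion.HasConvergenceRate
          (fun n => (M.ratio x v p (Companion.eLast r) q (Companion.eLast r) n : ℝ)) l ρ ∧
        Companion.HasConvergenceRate
          (fun n => (M.ratio x v p (Companion.evalVec a n) q (Companion.evalVec a n) n : ℝ)) l ρ ∧
        ∀ U : Fin r → ℕ → ℂ, Companion.IsPerronSystem b lam U →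
          ∃ c c' : Fin r → ℂ,
            Companion.IsExpansion U (fun n => (M.pairing x v p (Companion.eFirst r) n : ℂ)) c ∧
            Companion.IsExpansion U (fun n => (M.pairing x v q (Companion.eFirst r) n : ℂ)) c' ∧
            ∃ j : Fin r,
              Companion.IsFirstNonzero c' j ∧ (∀ i < j, c i = 0) ∧ (l : ℂ) = c j / c' j ∧
              (∀ k : Fin r, Companion.IsFirstNonzero (fun i => c' j * c i - c j * c' i) k →
                j < k ∧ ρ = ENNReal.log ‖lam k / lam j‖ₑ) ∧
              ((∀ i, c' j * c i - c j * c' i = 0) → ρ = ⊥) := by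
  open Companion in
  have hr := pos_of_irreducible_recOp hirr
  have hb0 := companionMatrix_coeff_ne_zero hr hcomp
  have hlam : StrictAnti fun i => ‖lam i‖ := hPP.choose_spec.2.2
  have hsys : ∀ a : Fin r → RatFunc ℚ, a ≠ 0 → ∃ U : Fin r → ℕ → ℂ, IsPerronSystem b lam U ∧
      (∀ i, ∀ᶠ n in atTop, ∑ m : Fin r, evalC (a m) n * U i (n + m) ≠ 0) ∧
      ∀ i, Tendsto (fun n => (∑ m : Fin r, evalC (a m) (n + 1) * U i (n + 1 + m)) /
        ∑ m : Fin r, evalC (a m) n * U i (n + m)) atTop (𝓝 (lam i)) := by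
    intro a ha
    choose U h1 h2 h3 h4 h5 using exists_perron_solution hr hPP hb0 hirr ha
    exact ⟨U, ⟨h1, h2, h3⟩, h4, h5⟩
  refine ⟨?_, fun a ha p q l ⟨hne, hl⟩ => ?_⟩
  · obtain ⟨U, hU, -⟩ := hsys (Pi.single ⟨0, hr⟩ 1) (by simp)
    exact ⟨U, hU⟩
  obtain ⟨hp1, hp2, hp3⟩ := CMF.pairing_eFirst hr hdef hT hcomp p
  obtain ⟨hq1, hq2, hq3⟩ := CMF.pairing_eFirst hr hdef hT hcomp q
  have hs : ∀ᶠ n in atTop, ((M.ratio x v p (eLast r) q (eLast r) n : ℝ) : ℂ) =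
      (M.pairing x v p (eFirst r) (n + (r - 1)) : ℂ) / M.pairing x v q (eFirst r) (n + (r - 1)) := by
    filter_upwards [hp2, hq2] with n h1 h2
    rw [← h1, ← h2, CMF.ratio]
    push_cast
    rfl
  have hne' : ∀ᶠ n in atTop, (M.pairing x v q (eFirst r) (n + (r - 1)) : ℂ) ≠ 0 := by
    filter_upwards [hq2, hne] with n h1 h2
    rw [← h1]
    exact_mod_cast h2
  have hlead := fun (U : Fin r → ℕ → ℂ) (hU : IsPerronSystem b lam U) =>
    hU.exists_leading hlam hp1 hq1 hs hne' hl
  -- A system adapted to `a` suffices for convergence and for the common rate: applying `A` keeps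
  -- the coefficients `c` and `c'`, so both ratios have the same `j` and `k`.
  obtain ⟨U, hU, hV0, hV⟩ := hsys a ha
  obtain ⟨c, c', hc, hc', j, hj, hcj, hlj, hrate, hrate0⟩ := hlead U hU
  have hs' : ∀ᶠ n in atTop, ((M.ratio x v p (evalVec a n) q (evalVec a n) n : ℝ) : ℂ) =
      (∑ m : Fin r, evalC (a m) n * M.pairing x v p (eFirst r) (n + m)) /
        ∑ m : Fin r, evalC (a m) n * M.pairing x v q (eFirst r) (n + m) := by
    filter_upwards [hp3 a, hq3 a] with n h1 h2
    rw [← h1, ← h2, CMF.ratio]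
    push_cast
    rfl
  obtain ⟨hne2, hl2, hrate2, hrate20⟩ := convergence_of_leading hlam hV0 hV (hc.operator a)
    (hc'.operator a) hs' hj hcj hlj
  refine ⟨⟨?_, hl2⟩, ?_⟩
  · filter_upwards [hne2, hq3 a] with n h1 h2 h0
    rw [← h2, h0] at h1
    simp at h1
  have hρ : ∃ ρ, HasConvergenceRate
      (fun n => (M.ratio x v p (eLast r) q (eLast r) n : ℝ)) l ρ ∧ HasConvergenceRate
      (fun n => (M.ratio x v p (evalVec a n) q (evalVec a n) n : ℝ)) l ρ := by
    by_cases h0 : ∀ i, c' j * c i - c j * c' i = 0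
    · exact ⟨⊥, hrate0 h0, hrate20 h0⟩
    · obtain ⟨k, hk⟩ := exists_isFirstNonzero (c := fun i => c' j * c i - c j * c' i)
        fun h => h0 fun i => congrFun h i
      exact ⟨_, (hrate k hk).2, (hrate2 k hk).2⟩
  obtain ⟨ρ, hρ1, hρ2⟩ := hρ
  -- For an arbitrary Perron system only the `e_r` ratio is analysed; uniqueness of limits
  -- identifies its rate with `ρ`.
  refine ⟨ρ, hρ1, hρ2, fun U hU => ?_⟩
  obtain ⟨c, c', hc, hc', j, hj, hcj, hlj, hrate, hrate0⟩ := hlead U hU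
  exact ⟨c, c', hc, hc', j, hj, hcj, hlj,
    fun k hk => ⟨(hrate k hk).1, tendsto_nhds_unique hρ1 (hrate k hk).2⟩,
    fun h0 => tendsto_nhds_unique hρ1 (hrate0 h0)⟩
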